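/- Let $\mathfrak P$ be a finite-dimensional projective space over a commutative field of characteristic $\neq 2$, let $T,B$ be disjoint subspaces of $\mathfrak P$ ($T$ may be empty), and let $Q$ be a nondegenerate ruled quadric in $B$ (i.e. $Q$ contains a projective line). Let $S_0$ be the projective cone with vertex $T$ over $Q$ and $S=S_0\setminus T$. The generalized Laguerre space $\mathfrak L$ has point set $S$. Its set of lines $\mathcal L$ consists of the nonempty sets $S\cap \ell$, where $\ell$ is a projective line contained in $S_0$; its set of cycles $\mathcal C$ consists of the sections of $S$ by planes that are nondegenerate nonempty conics. Put $\wp_1=\mathcal C\cup\mathcal L$ (the 1-subspaces). Let $\wp_2$ (the 2-subspaces) be the family of all sections of $S$ by projective subspaces of one of the following kinds: $E\setminus T$, where $E\subseteq S_0$ is a projective plane meeting $T$ in the empty set (projective planes), in a point (semiaffine planes), or in a line (affine planes); affine cones, i.e. sections by a 3-dimensional projective subspace that are a quadratic cone over a nondegenerate nonempty conic with its vertex, a point of $T$, deleted; projective cones, defined likewise but with vertex a point of $S$ (not deleted); Möbius planes and Minkowski planes, i.e. sections by a 3-dimensional projective subspace that are nondegenerate 2-dimensional quadrics of index $0$ (nonempty,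 containing no line), respectively of index $1$ (ruled). A cone is an affine cone or a projective cone. Let $\mathrm{Gr}(1,\mathfrak L)=\langle \wp_1,\wp_2,\subset\rangle$, regarded as a two-sorted first-order structure. Then: 1. A 2-subspace $Z\in\wp_2$ is a cone if and only if there are distinct $Y,Y'\in\mathcal L$ with $Y,Y'\subset Z$, and for all distinct $Y,Y'\in\mathcal L$ with $Y,Y'\subset Z$ there is $Z'\in\wp_2$ with $Y,Y'\subset Z'\neq Z$. 2. Assume that $\mathfrak L$ is not itself a single Minkowski plane, i.e. that the span of $T\cup B$ has projective dimension at least $4$. A 2-subspace $Z\in\wp_2$ is a Minkowski plane if and only if there are $Z'\in\wp_2$, $Z'\neq Z$, and distinct $Y,Y'\in\mathcal L$ with $Y,Y'\subset Z$ and $Y,Y'\subset Z'$, and $Z$ is not a cone. 3. The class of all cones and the class of all Minkowski planes of $\mathfrak L$ are each definable, by a first-order formula without parameters, in $\mathrm{Gr}(1,\mathfrak L)$. -/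

import Mathlib

open scoped LinearAlgebra.Projectivization

namespace Laguerre

section Geometry

variable {K V : Type*} [Field K] [AddCommGroup V] [Module K V]

/-- The set of points of the projective space `ℙ K V` lying on the projective subspace given by
the linear subspace `W`. The projective dimension of `pts W` is `finrank W - 1`. -/
def pts (W : Submodule K V) : Set (ℙ K V) :=
  {p | p.submodule ≤ W}

/-- `v = t + b` with `t ∈ T`, `b ∈ B` and `q b = 0`. For disjoint `T`, `B` this says that `v` is
in `T + B` and is singular for the (degenerate) quadratic form `t + b ↦ q b`. -/
def Singular (T B : Submodule K V) (q : QuadraticForm K B) (v : V) : Prop :=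
  ∃ t ∈ T, ∃ b : B, v = t + (b : V) ∧ q b = 0

/-- `x` and `y` are in `T + B` and are orthogonal for the polar form of `t + b ↦ q b`. -/
def Conjugate (T B : Submodule K V) (q : QuadraticForm K B) (x y : V) : Prop :=
  ∃ t ∈ T, ∃ b : B, ∃ t' ∈ T, ∃ b' : B,
    x = t + (b : V) ∧ y = t' + (b' : V) ∧ QuadraticMap.polar q b b' = 0

/-- A linear subspace all of whose vectors are singular. -/
def TotallySingular (T B : Submodule K V) (q : QuadraticForm K B) (U : Submodule K V) : Prop :=
  ∀ v ∈ U, Singular T B q v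

/-- The projective cone with vertex `T` over the quadric `q = 0` of `B`: the points on `T`, the
points of the quadric, and all points on lines joining a point of `T` to a point of the
quadric. -/
def cone (T B : Submodule K V) (q : QuadraticForm K B) : Set (ℙ K V) :=
  {p | ∀ v ∈ p.submodule, Singular T B q v}

/-- The points of the Laguerre space: the cone with its vertex deleted. -/
def points (T B : Submodule K V) (q : QuadraticForm K B) : Set (ℙ K V) :=
  cone T B q \ pts T

/-- The nondegenerate quadric `q = 0` is ruled: it contains a projective line. -/
def Ruled {B : Submodule K V} (q : QuadraticForm K B) : Prop :=
  ∃ U : Submodule K B, Module.finrank K U = 2 ∧ ∀ u ∈ U, q u = 0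

/-- The lines of the Laguerre space: nonempty traces on `points` of projective lines contained
in the cone. -/
def lines (T B : Submodule K V) (q : QuadraticForm K B) : Set (Set (ℙ K V)) :=
  {Y | ∃ U : Submodule K V, Module.finrank K U = 2 ∧ pts U ⊆ cone T B q ∧
    Y = points T B q ∩ pts U ∧ Y.Nonempty}

/-- The section of the cone by the subspace `D` of `T + B` is a nondegenerate `d`-dimensional
quadric of index `w`: `D` has projective dimension `d + 1`, the form restricted to `D` is
nondegenerate, and `w` is the largest projective dimension of a projective subspace of `D`
contained in the cone. -/
def IsBase (T B : Submodule K V) (q : QuadraticForm K B) (d w : ℕ) (D : Submodule K V) : Prop :=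
  D ≤ T ⊔ B ∧ Module.finrank K D = d + 2 ∧
  (∀ x ∈ D, (∀ y ∈ D, Conjugate T B q x y) → x = 0) ∧
  (∃ U ≤ D, TotallySingular T B q U ∧ Module.finrank K U = w + 1) ∧
  (∀ U ≤ D, TotallySingular T B q U → Module.finrank K U ≤ w + 1)

/-- The affine cones with `m`-dimensional affine generator, over a projective cone with
`m'`-dimensional projective generator, whose basis is a nondegenerate `d`-dimensional quadric of
index `w`. The basis is the section by `D`; `R` is the vertex of the projective part
(of projective dimension `m' - w - 1`), and `A`, of projective dimension `m - 1`, is the (deleted)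
vertex at infinity. The affine cone is the section by `A + R + D`. -/
def coneClass (T B : Submodule K V) (q : QuadraticForm K B) (m m' d w : ℕ) :
    Set (Set (ℙ K V)) :=
  {X | ∃ A R D : Submodule K V,
    A ≤ T ∧ Module.finrank K A = m ∧
    Disjoint R T ∧ Module.finrank K R + w = m' ∧
    IsBase T B q d w D ∧ Disjoint (A ⊔ R) D ∧
    (∀ x ∈ R, ∀ y ∈ R ⊔ D, Conjugate T B q x y) ∧
    X = points T B q ∩ pts (A ⊔ R ⊔ D)}

/-- The `(m + d)`-dimensional generators whose maximal affine subgenerator has dimension `m`: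
traces of `(m + d)`-dimensional projective subspaces contained in the cone that meet `T` in
projective dimension `m - 1`. -/
def generatorClass (T B : Submodule K V) (q : QuadraticForm K B) (m d : ℕ) :
    Set (Set (ℙ K V)) :=
  {X | ∃ W : Submodule K V, TotallySingular T B q W ∧ Module.finrank K W = m + d + 1 ∧
    Module.finrank K (W ⊓ T : Submodule K V) = m ∧ X = points T B q ∩ pts W}

/-- The cycles: sections of the point set that are nondegenerate nonempty conics. -/
def cycles (T B : Submodule K V) (q : QuadraticForm K B) : Set (Set (ℙ K V)) :=
  coneClass T B q 0 0 1 0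

/-- Projective planes. -/
def projPlanes (T B : Submodule K V) (q : QuadraticForm K B) : Set (Set (ℙ K V)) :=
  generatorClass T B q 0 2

/-- Semiaffine planes: projective planes with one point deleted. -/
def semiaffPlanes (T B : Submodule K V) (q : QuadraticForm K B) : Set (Set (ℙ K V)) :=
  generatorClass T B q 1 1

/-- Affine planes: projective planes with a line deleted. -/
def affPlanes (T B : Submodule K V) (q : QuadraticForm K B) : Set (Set (ℙ K V)) :=
  generatorClass T B q 2 0

/-- Affine cones: cones over conics whose vertex is a (deleted) point of `T`. -/
def affCones (T B : Submodule K V) (q : QuadraticForm K B) : Set (Set (ℙ K V)) :=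
  coneClass T B q 1 0 1 0

/-- Projective cones: cones over conics whose vertex is a point of the Laguerre space. -/
def projCones (T B : Submodule K V) (q : QuadraticForm K B) : Set (Set (ℙ K V)) :=
  coneClass T B q 0 1 1 0

/-- Möbius planes: nondegenerate 2-dimensional quadrics of index 0. -/
def mobiusPlanes (T B : Submodule K V) (q : QuadraticForm K B) : Set (Set (ℙ K V)) :=
  coneClass T B q 0 0 2 0

/-- Minkowski planes: nondegenerate 2-dimensional quadrics of index 1. -/
def minkowskiPlanes (T B : Submodule K V) (q : QuadraticForm K B) : Set (Set (ℙ K V)) :=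
  coneClass T B q 0 1 2 1

/-- The 1-subspaces. -/
def subspaces1 (T B : Submodule K V) (q : QuadraticForm K B) : Set (Set (ℙ K V)) :=
  cycles T B q ∪ lines T B q

/-- The 2-subspaces. -/
def subspaces2 (T B : Submodule K V) (q : QuadraticForm K B) : Set (Set (ℙ K V)) :=
  projPlanes T B q ∪ semiaffPlanes T B q ∪ affPlanes T B q ∪ affCones T B q ∪ projCones T B q ∪
    mobiusPlanes T B q ∪ minkowskiPlanes T B q

/-- The universe of the Grassmann space: the two sorts, 1-subspaces and 2-subspaces. -/
def Gr (T B : Submodule K V) (q : QuadraticForm K B) : Type _ :=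
  ↥(subspaces1 T B q) ⊕ ↥(subspaces2 T B q)

end Geometry

/-- The relation symbols of the Grassmann space: one unary predicate for each of the two sorts,
and one binary symbol for inclusion. -/
inductive GrRel : ℕ → Type
  | isOne : GrRel 1
  | isTwo : GrRel 1
  | incl : GrRel 2

/-- The first-order language of the Grassmann space (no function symbols). -/
def grLanguage : FirstOrder.Language :=
  ⟨fun _ => Empty, GrRel⟩

/-- Interpretation of the inclusion symbol: a 1-subspace is contained in a 2-subspace. -/
def grIncl {K V : Type*} [Field K] [AddCommGroup V] [Module K V] {T B : Submodule K V}
    {q : QuadraticForm K B} : Gr T B q → Gr T B q → Prop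
  | Sum.inl Y, Sum.inr Z => Y.1 ⊆ Z.1
  | _, _ => False

/-- The Grassmann space of 1-subspaces as a first-order structure. -/
instance grStructure {K V : Type*} [Field K] [AddCommGroup V] [Module K V] (T B : Submodule K V)
    (q : QuadraticForm K B) : grLanguage.Structure (Gr T B q) where
  funMap := fun f _ => Empty.elim f
  RelMap := fun r x =>
    match r, x with
    | GrRel.isOne, x => ∃ Y, x 0 = Sum.inl Y
    | GrRel.isTwo, x => ∃ Z, x 0 = Sum.inr Z
    | GrRel.incl, x => grIncl (x 0) (x 1)

/-- A class of 2-subspaces is definable in the Grassmann space: it is defined there by a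
first-order formula without parameters. -/
def DefinableClass {K V : Type*} [Field K] [AddCommGroup V] [Module K V] (T B : Submodule K V)
    (q : QuadraticForm K B) (𝒳 : Set (Set (ℙ K V))) : Prop :=
  Set.Definable₁ (∅ : Set (Gr T B q)) grLanguage
    {x : Gr T B q | ∃ Z : ↥(subspaces2 T B q), x = Sum.inr Z ∧ Z.1 ∈ 𝒳}

end Laguerre

/-! ### The polar form on the ambient space and totally singular subspaces -/

namespace Laguerre

open Module Submodule

variable {K V : Type*} [Field K] [AddCommGroup V] [Module K V]

/-! Projection along `T` pulls the polar form of `q` back to a symmetric form `β` on `V` whose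
radical on `T ⊔ B` is `T`. As `2 ≠ 0`, the cone consists of the `β`-isotropic points of `T ⊔ B`, and
the geometry becomes linear algebra. Lines are sections by two-dimensional totally singular
subspaces not inside `T`. A 2-subspace is the section by some `F`, either totally singular of
dimension three (a plane) or of dimension four with no totally singular subspace of dimension three
(`exists_eq_sec`). Lines and nonempty nondegenerate quadrics span their subspaces
(`sec_subset_iff_of_TS`, `sec_subset_iff_of_isBase`), so inclusion of sections is inclusion of
subspaces.

Two lines in a plane, or two skew lines in a Minkowski plane, span all of `F` and lie in no other
2-subspace (`eq_sec_plane`, `eq_sec_hyperbolic`). Two lines of a cone meet in its vertex and span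
only a degenerate three-dimensional space, which extends to another 2-subspace
(`exists_ne_sec_cone`); so do two intersecting lines of a Minkowski plane once `T ⊔ B` has dimension
at least five (`exists_ne_sec_hyperbolic`). Möbius planes contain no lines. So sharing two lines
with another 2-subspace singles out cones and Minkowski planes, and a skew pair tells these apart.

The language does not separate lines from cycles. But a cycle and another 1-subspace lie together in
at most one 2-subspace (`mem_lines_of_subset`), so 1-subspaces shared by pairs are lines, and in
dimension at least five these suffice for both criteria. In dimension four every 2-subspace is a
Minkowski plane. -/

/-- `β` is a symmetric bilinear form on the whole space that describes the singular vectors and the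
conjugate pairs of the degenerate quadratic form `t + b ↦ q b` on `T + B`. -/
structure IsPolar (T B : Submodule K V) (q : QuadraticForm K B) (β : LinearMap.BilinForm K V) :
    Prop where
  two_ne : (2 : K) ≠ 0
  symm : ∀ x y, β x y = β y x
  singular_iff : ∀ v, Singular T B q v ↔ v ∈ T ⊔ B ∧ β v v = 0
  conjugate_iff : ∀ x y, Conjugate T B q x y ↔ x ∈ T ⊔ B ∧ y ∈ T ⊔ B ∧ β x y = 0
  vertex_left : ∀ x ∈ T, ∀ y, β x y = 0
  radical : ∀ x ∈ T ⊔ B, (∀ y ∈ T ⊔ B, β x y = 0) → x ∈ T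

/-- Since `T` and `B` are disjoint, `B → V ⧸ T` is injective and has a left inverse `g`; the form is
the polar form of `q` pulled back along `V → V ⧸ T → B`. On `t + b` it takes the value `2 * q b`,
whence the need for `2 ≠ 0`. -/
theorem exists_isPolar (hK : (2 : K) ≠ 0) (T B : Submodule K V) (hTB : Disjoint T B)
    (q : QuadraticForm K B) (hq : (QuadraticMap.polarBilin q).Nondegenerate) :
    ∃ β, IsPolar T B q β := by
  obtain ⟨g, hg⟩ := LinearMap.exists_leftInverse_of_injective (T.mkQ ∘ₗ B.subtype) (by
    rw [LinearMap.ker_comp, ker_mkQ, eq_bot_iff]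
    rintro ⟨x, hx⟩ hxT
    simpa using disjoint_def.1 hTB x hxT hx)
  have hb : ∀ b : B, g (T.mkQ b) = b := fun b => LinearMap.congr_fun hg b
  have ht : ∀ t ∈ T, g (T.mkQ t) = 0 := fun t ht => by
    rw [mkQ_apply, (Quotient.mk_eq_zero T).2 ht, map_zero]
  have htb : ∀ t ∈ T, ∀ b : B, g (T.mkQ (t + b)) = b := fun t h b => by
    rw [map_add, map_add, ht t h, hb, zero_add]
  have hsup : ∀ v ∈ T ⊔ B, ∃ t ∈ T, ∃ b : B, v = t + (b : V) := fun v hv => by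
    obtain ⟨t, h, b, hb, rfl⟩ := mem_sup.1 hv
    exact ⟨t, h, ⟨b, hb⟩, rfl⟩
  have hin : ∀ t ∈ T, ∀ b : B, t + (b : V) ∈ T ⊔ B := fun t h b => add_mem_sup h b.2
  refine ⟨(QuadraticMap.polarBilin q).compl₁₂ (g ∘ₗ T.mkQ) (g ∘ₗ T.mkQ), hK, ?_, ?_, ?_, ?_, ?_⟩
  · intro x y
    simp [QuadraticMap.polar_comm]
  · intro v
    constructor
    · rintro ⟨t, h, b, rfl, h0⟩
      refine ⟨hin t h b, ?_⟩
      rw [LinearMap.compl₁₂_apply, LinearMap.comp_apply, htb t h]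
      simp [QuadraticMap.polar_self, h0]
    · rintro ⟨hv, h0⟩
      obtain ⟨t, h, b, rfl⟩ := hsup v hv
      rw [LinearMap.compl₁₂_apply, LinearMap.comp_apply, htb t h] at h0
      simp only [QuadraticMap.polarBilin_apply_apply, QuadraticMap.polar_self, nsmul_eq_mul,
        Nat.cast_ofNat, mul_eq_zero, hK, false_or] at h0
      exact ⟨t, h, b, rfl, by simpa [hK] using h0⟩
  · intro x y
    constructor
    · rintro ⟨t, h, b, t', h', b', rfl, rfl, h0⟩
      refine ⟨hin t h b, hin t' h' b', ?_⟩
      rw [LinearMap.compl₁₂_apply, LinearMap.comp_apply, LinearMap.comp_apply, htb t h, htb t' h']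
      exact h0
    · rintro ⟨hx, hy, h0⟩
      obtain ⟨t, h, b, rfl⟩ := hsup x hx
      obtain ⟨t', h', b', rfl⟩ := hsup y hy
      rw [LinearMap.compl₁₂_apply, LinearMap.comp_apply, LinearMap.comp_apply, htb t h,
        htb t' h'] at h0
      exact ⟨t, h, b, t', h', b', rfl, rfl, h0⟩
  · intro x hx y
    rw [LinearMap.compl₁₂_apply, LinearMap.comp_apply, ht x hx, map_zero, LinearMap.zero_apply]
  · intro x hx h
    obtain ⟨t, hxT, b, rfl⟩ := hsup x hx
    have : b = 0 := hq.1 b fun y => by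
      have h0 := h y (mem_sup_right y.2)
      rw [LinearMap.compl₁₂_apply, LinearMap.comp_apply, LinearMap.comp_apply, htb t hxT, hb] at h0
      exact h0
    simpa [this] using hxT

/-- The section of the point set by a subspace. -/
def sec (T B : Submodule K V) (q : QuadraticForm K B) (F : Submodule K V) : Set (ℙ K V) :=
  points T B q ∩ pts F

/-- A nondegenerate subspace with respect to `β`. -/
def Nondeg (β : LinearMap.BilinForm K V) (D : Submodule K V) : Prop :=
  ∀ x ∈ D, (∀ y ∈ D, β x y = 0) → x = 0

/-- `U` is a totally singular subspace of `W`. -/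
def TS (β : LinearMap.BilinForm K V) (W U : Submodule K V) : Prop :=
  ∀ v ∈ U, v ∈ W ∧ β v v = 0

theorem mk_mem_pts {v : V} (hv : v ≠ 0) {W : Submodule K V} :
    Projectivization.mk K v hv ∈ pts W ↔ v ∈ W := by
  simp [pts, Projectivization.submodule_mk, span_singleton_le_iff_mem]

namespace IsPolar

variable {T B : Submodule K V} {q : QuadraticForm K B} {β : LinearMap.BilinForm K V}

section

variable (h : IsPolar T B q β)
include h

theorem vertex_right {x y : V} (hy : y ∈ T) : β x y = 0 := by
  rw [h.symm, h.vertex_left y hy]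

theorem totallySingular_iff {U : Submodule K V} : TotallySingular T B q U ↔ TS β (T ⊔ B) U :=
  forall₂_congr fun v _ => h.singular_iff v

theorem mk_mem_cone {v : V} (hv : v ≠ 0) :
    Projectivization.mk K v hv ∈ cone T B q ↔ v ∈ T ⊔ B ∧ β v v = 0 := by
  simp only [cone, Set.mem_ofPred_eq, Projectivization.submodule_mk, h.singular_iff]
  refine ⟨fun H => H v (mem_span_singleton_self v), fun H w hw => ?_⟩
  obtain ⟨c, rfl⟩ := mem_span_singleton.1 hw
  exact ⟨smul_mem _ _ H.1, by simp [H.2]⟩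

theorem mk_mem_sec {v : V} (hv : v ≠ 0) {F : Submodule K V} :
    Projectivization.mk K v hv ∈ sec T B q F ↔ (v ∈ T ⊔ B ∧ β v v = 0) ∧ v ∉ T ∧ v ∈ F := by
  rw [sec, points, Set.mem_inter_iff, Set.mem_sdiff, h.mk_mem_cone, mk_mem_pts, mk_mem_pts,
    and_assoc]

theorem sec_subset_iff {F F' : Submodule K V} : sec T B q F ⊆ sec T B q F' ↔
    ∀ v ∈ T ⊔ B, β v v = 0 → v ∉ T → v ∈ F → v ∈ F' := by
  constructor
  · intro H v hv h0 hT hF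
    have hv0 : v ≠ 0 := by rintro rfl; exact hT T.zero_mem
    exact ((h.mk_mem_sec hv0).1 (H ((h.mk_mem_sec hv0).2 ⟨⟨hv, h0⟩, hT, hF⟩))).2.2
  · intro H p
    induction p using Projectivization.ind with
    | h v hv =>
      rw [h.mk_mem_sec, h.mk_mem_sec]
      exact fun H' => ⟨H'.1, H'.2.1, H v H'.1.1 H'.1.2 H'.2.1 H'.2.2⟩

theorem pts_subset_cone_iff {U : Submodule K V} : pts U ⊆ cone T B q ↔ TS β (T ⊔ B) U := by
  constructor
  · intro H v hv
    rcases eq_or_ne v 0 with rfl | hv0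
    · simp
    · exact (h.mk_mem_cone hv0).1 (H ((mk_mem_pts hv0).2 hv))
  · intro H p
    induction p using Projectivization.ind with
    | h v hv =>
      rw [h.mk_mem_cone, mk_mem_pts]
      exact H v

theorem mem_lines_iff {Y : Set (ℙ K V)} : Y ∈ lines T B q ↔
    ∃ U : Submodule K V, finrank K U = 2 ∧ TS β (T ⊔ B) U ∧ ¬U ≤ T ∧ Y = sec T B q U := by
  constructor
  · rintro ⟨U, hU, hc, rfl, p, hp⟩
    refine ⟨U, hU, h.pts_subset_cone_iff.1 hc, fun hUT => ?_, rfl⟩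
    exact hp.1.2 (hp.2.trans hUT)
  · rintro ⟨U, hU, hc, hT, rfl⟩
    refine ⟨U, hU, h.pts_subset_cone_iff.2 hc, rfl, ?_⟩
    obtain ⟨v, hv, hvT⟩ := SetLike.not_le_iff_exists.1 hT
    have hv0 : v ≠ 0 := by rintro rfl; exact hvT T.zero_mem
    exact ⟨_, (h.mk_mem_sec hv0).2 ⟨hc v hv, hvT, hv⟩⟩

theorem isBase_iff {d w : ℕ} {D : Submodule K V} : IsBase T B q d w D ↔
    D ≤ T ⊔ B ∧ finrank K D = d + 2 ∧ Nondeg β D ∧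
    (∃ U ≤ D, TS β (T ⊔ B) U ∧ finrank K U = w + 1) ∧
    (∀ U ≤ D, TS β (T ⊔ B) U → finrank K U ≤ w + 1) := by
  simp only [IsBase, h.totallySingular_iff, Nondeg, h.conjugate_iff]
  refine and_congr_right fun hD => and_congr_right fun _ => and_congr_left fun _ =>
    forall₂_congr fun x hx => imp_congr_left <| forall₂_congr fun y hy => ?_
  simp [hD hx, hD hy]

end

end IsPolar

/-- Polarization: expanding `β (x + y) (x + y) = 0` leaves `2 * β x y = 0`. -/
theorem TS.apply_eq_zero {β : LinearMap.BilinForm K V} {W U : Submodule K V} (hU : TS β W U)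
    (h2 : (2 : K) ≠ 0) (hs : ∀ x y, β x y = β y x) {x y : V} (hx : x ∈ U) (hy : y ∈ U) :
    β x y = 0 := by
  have h1 := (hU _ (U.add_mem hx hy)).2
  simp only [map_add, LinearMap.add_apply, (hU x hx).2, (hU y hy).2, hs y x] at h1
  have : 2 * β x y = 0 := by linear_combination h1
  exact (mul_eq_zero.1 this).resolve_left h2

theorem TS.mono {β : LinearMap.BilinForm K V} {W U U' : Submodule K V} (hU : TS β W U)
    (hle : U' ≤ U) : TS β W U' := fun v hv => hU v (hle hv)

theorem TS.sup {β : LinearMap.BilinForm K V} {W U U' : Submodule K V} (hU : TS β W U)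
    (hU' : TS β W U') (hs : ∀ x y, β x y = β y x) (horth : ∀ x ∈ U, ∀ y ∈ U', β x y = 0) :
    TS β W (U ⊔ U') := by
  intro v hv
  obtain ⟨x, hx, y, hy, rfl⟩ := mem_sup.1 hv
  refine ⟨W.add_mem (hU x hx).1 (hU' y hy).1, ?_⟩
  simp [(hU x hx).2, (hU' y hy).2, horth x hx y hy, hs y x]

theorem TS.span_singleton {β : LinearMap.BilinForm K V} {W : Submodule K V} {x : V} (hx : x ∈ W)
    (h0 : β x x = 0) : TS β W (K ∙ x) := by
  intro v hv
  obtain ⟨c, rfl⟩ := mem_span_singleton.1 hv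
  exact ⟨smul_mem _ _ hx, by simp [h0]⟩

theorem TS.span_pair {β : LinearMap.BilinForm K V} {W : Submodule K V} {x y : V}
    (hs : ∀ x y, β x y = β y x) (hx : x ∈ W) (hy : y ∈ W)
    (h0 : β x x = 0) (h1 : β y y = 0) (h01 : β x y = 0) : TS β W (span K {x, y}) := by
  intro v hv
  obtain ⟨a, b, rfl⟩ := mem_span_pair.1 hv
  exact ⟨W.add_mem (smul_mem _ _ hx) (smul_mem _ _ hy), by simp [h0, h1, h01, hs y x]⟩

theorem Nondeg.isCompl [FiniteDimensional K V] {β : LinearMap.BilinForm K V} {D : Submodule K V}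
    (hD : Nondeg β D) (hs : ∀ x y, β x y = β y x) : IsCompl D (β.orthogonal D) := by
  refine LinearMap.BilinForm.isCompl_orthogonal_of_restrict_nondegenerate
    (fun x y hxy => by rw [hs, hxy]) ⟨fun x hx => ?_, fun x hx => ?_⟩
  · exact Subtype.ext (hD x x.2 fun y hy => hx ⟨y, hy⟩)
  · exact Subtype.ext (hD x x.2 fun y hy => by rw [hs]; exact hx ⟨y, hy⟩)

/-- Every vector is a sum of one in a nondegenerate subspace `D` and one orthogonal to `D`. -/
theorem Nondeg.exists_sub_orthogonal [FiniteDimensional K V] {β : LinearMap.BilinForm K V}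
    {D : Submodule K V} (hD : Nondeg β D) (hs : ∀ x y, β x y = β y x) (x : V) :
    ∃ d ∈ D, ∀ y ∈ D, β (x - d) y = 0 := by
  obtain ⟨d, hd, e, he, rfl⟩ := mem_sup.1
    ((hD.isCompl hs).sup_eq_top.symm ▸ mem_top : x ∈ D ⊔ β.orthogonal D)
  refine ⟨d, hd, fun y hy => ?_⟩
  rw [add_sub_cancel_left, hs]
  exact he y hy

/-- A totally singular subspace of a nondegenerate subspace has at most half its dimension. -/
theorem Nondeg.two_mul_finrank_le [FiniteDimensional K V] {β : LinearMap.BilinForm K V}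
    {D U W : Submodule K V} (hD : Nondeg β D) (h2 : (2 : K) ≠ 0) (hs : ∀ x y, β x y = β y x)
    (hle : U ≤ D) (hU : TS β W U) : 2 * finrank K U ≤ finrank K D := by
  have hnd : (β.restrict D).Nondegenerate := by
    refine ⟨fun x hx => ?_, fun x hx => ?_⟩
    · exact Subtype.ext (hD x x.2 fun y hy => hx ⟨y, hy⟩)
    · exact Subtype.ext (hD x x.2 fun y hy => by rw [hs]; exact hx ⟨y, hy⟩)
  -- Inside `D` the complement of `U` has dimension `finrank D - finrank U`, and it contains `U`.
  have h1 := LinearMap.BilinForm.finrank_orthogonal hnd (U.comap D.subtype)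
  have h3 : finrank K (U.comap D.subtype) = finrank K U :=
    (comapSubtypeEquivOfLe hle).finrank_eq
  have h4 : U.comap D.subtype ≤ (β.restrict D).orthogonal (U.comap D.subtype) :=
    fun x hx y hy => hU.apply_eq_zero h2 hs hy hx
  have h5 := finrank_mono h4
  have h6 := finrank_mono hle
  omega

end Laguerre

/-! ### Hyperbolic bases, cones, and the span of a section -/

namespace Laguerre

open Module Submodule

variable {K V : Type*} [Field K] [AddCommGroup V] [Module K V]

/-- `F` is a quadratic cone with vertex `a` over the conic cut out by `D`. -/
structure IsConeOver (T B : Submodule K V) (q : QuadraticForm K B) (β : LinearMap.BilinForm K V)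
    (a : V) (D : Submodule K V) : Prop where
  ne_zero : a ≠ 0
  mem : a ∈ T ⊔ B
  singular : β a a = 0
  base : IsBase T B q 1 0 D
  orth : ∀ y ∈ D, β a y = 0

/-- The vectors form a hyperbolic basis, up to scalars, of a subspace of `T + B`. -/
structure IsHyperbolic (T B : Submodule K V) (β : LinearMap.BilinForm K V) (e₁ e₂ f₁ f₂ : V) :
    Prop where
  e₁_mem : e₁ ∈ T ⊔ B
  e₂_mem : e₂ ∈ T ⊔ B
  f₁_mem : f₁ ∈ T ⊔ B
  f₂_mem : f₂ ∈ T ⊔ B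
  e₁e₁ : β e₁ e₁ = 0
  e₂e₂ : β e₂ e₂ = 0
  f₁f₁ : β f₁ f₁ = 0
  f₂f₂ : β f₂ f₂ = 0
  e₁e₂ : β e₁ e₂ = 0
  f₁f₂ : β f₁ f₂ = 0
  e₁f₂ : β e₁ f₂ = 0
  e₂f₁ : β e₂ f₁ = 0
  e₁f₁ : β e₁ f₁ ≠ 0
  e₂f₂ : β e₂ f₂ ≠ 0

theorem mem_span_triple {x y z v : V} :
    v ∈ span K {x, y, z} ↔ ∃ a b c : K, v = a • x + b • y + c • z := by
  simp only [mem_span_insert, mem_span_singleton]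
  constructor
  · rintro ⟨a, _, ⟨b, _, ⟨c, rfl⟩, rfl⟩, rfl⟩
    exact ⟨a, b, c, by abel⟩
  · rintro ⟨a, b, c, rfl⟩
    exact ⟨a, _, ⟨b, _, ⟨c, rfl⟩, rfl⟩, by abel⟩

theorem mem_span_quadruple {x y z w v : V} :
    v ∈ span K {x, y, z, w} ↔ ∃ a b c d : K, v = a • x + b • y + c • z + d • w := by
  rw [mem_span_insert]
  simp only [mem_span_triple]
  constructor
  · rintro ⟨a, _, ⟨b, c, d, rfl⟩, rfl⟩
    exact ⟨a, b, c, d, by abel⟩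
  · rintro ⟨a, b, c, d, rfl⟩
    exact ⟨a, _, ⟨b, c, d, rfl⟩, by abel⟩

/-- The functional `β · z` kills `x` but not `y`, so `y` is no multiple of `x`. -/
theorem finrank_span_pair_eq_two {β : LinearMap.BilinForm K V} {x y z : V} (hx : x ≠ 0)
    (hxz : β x z = 0) (hyz : β y z ≠ 0) : finrank K (span K {x, y}) = 2 := by
  have hli : LinearIndependent K ![x, y] := by
    rw [LinearIndependent.pair_iff]
    intro s t hst
    have h1 : β (s • x + t • y) z = 0 := by rw [hst]; simp
    have ht : t = 0 := by simpa [hxz, hyz] using h1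
    subst ht
    exact ⟨by simpa [hx] using hst, rfl⟩
  have h1 := finrank_span_eq_card hli
  have h2 : Set.range ![x, y] = {x, y} := by
    simp only [Matrix.range_cons, Matrix.range_empty, Set.union_empty, Set.singleton_union]
  rw [h2] at h1
  simpa using h1

theorem exists_eq_span_singleton [FiniteDimensional K V] {A : Submodule K V}
    (hA : finrank K A = 1) : ∃ a, a ≠ 0 ∧ A = K ∙ a := by
  obtain ⟨a, ha, ha0⟩ := A.exists_mem_ne_zero_of_ne_bot (by
    rintro rfl
    simp at hA)
  exact ⟨a, ha0, (eq_of_le_of_finrank_eq ((span_singleton_le_iff_mem a A).2 ha)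
    (by rw [hA, finrank_span_singleton ha0])).symm⟩

namespace IsPolar

variable {T B : Submodule K V} {q : QuadraticForm K B} {β : LinearMap.BilinForm K V}
variable (h : IsPolar T B q β)
include h

theorem sec_span_pair_mem_lines {x y z : V} (hx : x ∈ T ⊔ B) (hy : y ∈ T ⊔ B) (hx0 : x ≠ 0)
    (hxx : β x x = 0) (hyy : β y y = 0) (hxy : β x y = 0) (hxz : β x z = 0) (hyz : β y z ≠ 0) :
    sec T B q (span K {x, y}) ∈ lines T B q :=
  h.mem_lines_iff.2 ⟨_, finrank_span_pair_eq_two hx0 hxz hyz,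
    TS.span_pair h.symm hx hy hxx hyy hxy,
    fun hT => hyz (h.vertex_left y (hT (subset_span (by simp))) z), rfl⟩

/-- A hyperbolic plane plus an orthogonal nonsingular vector: pairing with the generators recovers
the coefficients, which gives independence and nondegeneracy at once. The index is `0` because `2 *
finrank U ≤ 3`. -/
theorem isBase_span_triple [FiniteDimensional K V] {u v w : V} (hu : u ∈ T ⊔ B) (hv : v ∈ T ⊔ B)
    (hw : w ∈ T ⊔ B) (huu : β u u = 0) (hvv : β v v = 0) (huv : β u v ≠ 0) (hwu : β w u = 0)
    (hwv : β w v = 0) (hww : β w w ≠ 0) : IsBase T B q 1 0 (span K {u, v, w}) := by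
  have hvu : β v u ≠ 0 := by rwa [h.symm]
  have huw : β u w = 0 := by rwa [h.symm]
  have hvw : β v w = 0 := by rwa [h.symm]
  have hcoef : ∀ a b c : K, β (a • u + b • v + c • w) u = 0 → β (a • u + b • v + c • w) v = 0 →
      β (a • u + b • v + c • w) w = 0 → a = 0 ∧ b = 0 ∧ c = 0 := by
    intro a b c h1 h2 h3
    simp only [map_add, map_smul, LinearMap.add_apply, LinearMap.smul_apply, smul_eq_mul, huu, hwu,
      hvv, hwv, huw, hvw, mul_zero, add_zero, zero_add, mul_eq_zero, hvu, huv, hww, or_false]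
      at h1 h2 h3
    exact ⟨h2, h1, h3⟩
  have hli : LinearIndependent K ![u, v, w] := by
    rw [Fintype.linearIndependent_iff]
    intro g hg
    simp only [Fin.sum_univ_three, Matrix.cons_val_zero, Matrix.cons_val_one, Matrix.cons_val] at hg
    have := hcoef (g 0) (g 1) (g 2) (by rw [hg]; simp) (by rw [hg]; simp) (by rw [hg]; simp)
    intro i
    fin_cases i
    exacts [this.1, this.2.1, this.2.2]
  have hfr : finrank K (span K {u, v, w}) = 3 := by
    have h1 := finrank_span_eq_card hli
    have h2 : Set.range ![u, v, w] = {u, v, w} := by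
      simp only [Matrix.range_cons, Matrix.range_empty, Set.union_empty, Set.singleton_union]
    rw [h2] at h1
    simpa using h1
  have hnd : Nondeg β (span K {u, v, w}) := by
    intro x hx hx0
    obtain ⟨a, b, c, rfl⟩ := mem_span_triple.1 hx
    obtain ⟨rfl, rfl, rfl⟩ := hcoef a b c (hx0 _ (subset_span (by simp)))
      (hx0 _ (subset_span (by simp))) (hx0 _ (subset_span (by simp)))
    simp
  refine h.isBase_iff.2 ⟨?_, hfr, hnd, ⟨K ∙ u, ?_, TS.span_singleton hu huu, ?_⟩, fun U hU hts => ?_⟩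
  · rw [span_le]
    rintro x (rfl | rfl | rfl) <;> assumption
  · exact span_mono (by simp)
  · rw [zero_add, finrank_span_singleton]
    rintro rfl
    simp at huv
  · have := hnd.two_mul_finrank_le h.two_ne h.symm hU hts
    omega

theorem isBase_span_quadruple [FiniteDimensional K V] {e₁ e₂ f₁ f₂ : V}
    (H : IsHyperbolic T B β e₁ e₂ f₁ f₂) : IsBase T B q 2 1 (span K {e₁, e₂, f₁, f₂}) := by
  have h1 : β f₁ e₁ ≠ 0 := by rw [h.symm]; exact H.e₁f₁
  have h2 : β f₂ e₂ ≠ 0 := by rw [h.symm]; exact H.e₂f₂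
  have h3 : β e₂ e₁ = 0 := by rw [h.symm]; exact H.e₁e₂
  have h4 : β f₂ f₁ = 0 := by rw [h.symm]; exact H.f₁f₂
  have h5 : β f₂ e₁ = 0 := by rw [h.symm]; exact H.e₁f₂
  have h6 : β f₁ e₂ = 0 := by rw [h.symm]; exact H.e₂f₁
  have hcoef : ∀ a b c d : K, β (a • e₁ + b • e₂ + c • f₁ + d • f₂) e₁ = 0 →
      β (a • e₁ + b • e₂ + c • f₁ + d • f₂) e₂ = 0 →
      β (a • e₁ + b • e₂ + c • f₁ + d • f₂) f₁ = 0 →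
      β (a • e₁ + b • e₂ + c • f₁ + d • f₂) f₂ = 0 → a = 0 ∧ b = 0 ∧ c = 0 ∧ d = 0 := by
    intro a b c d g1 g2 g3 g4
    simp only [map_add, map_smul, LinearMap.add_apply, LinearMap.smul_apply, smul_eq_mul, H.e₁e₁,
      H.e₂e₂, H.f₁f₁, H.f₂f₂, H.e₁e₂, H.f₁f₂, H.e₁f₂, H.e₂f₁, h3, h4, h5, h6,
      mul_zero, add_zero, zero_add, mul_eq_zero, h1, h2, H.e₁f₁, H.e₂f₂, or_false] at g1 g2 g3 g4
    exact ⟨g3, g4, g1, g2⟩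
  have hli : LinearIndependent K ![e₁, e₂, f₁, f₂] := by
    rw [Fintype.linearIndependent_iff]
    intro g hg
    simp only [Fin.sum_univ_four, Matrix.cons_val_zero, Matrix.cons_val_one, Matrix.cons_val] at hg
    have := hcoef (g 0) (g 1) (g 2) (g 3) (by rw [hg]; simp) (by rw [hg]; simp) (by rw [hg]; simp)
      (by rw [hg]; simp)
    intro i
    fin_cases i
    exacts [this.1, this.2.1, this.2.2.1, this.2.2.2]
  have hfr : finrank K (span K {e₁, e₂, f₁, f₂}) = 4 := by
    have h1 := finrank_span_eq_card hli
    have h2 : Set.range ![e₁, e₂, f₁, f₂] = {e₁, e₂, f₁, f₂} := by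
      simp only [Matrix.range_cons, Matrix.range_empty, Set.union_empty, Set.singleton_union]
    rw [h2] at h1
    simpa using h1
  have hnd : Nondeg β (span K {e₁, e₂, f₁, f₂}) := by
    intro x hx hx0
    obtain ⟨a, b, c, d, rfl⟩ := mem_span_quadruple.1 hx
    obtain ⟨rfl, rfl, rfl, rfl⟩ := hcoef a b c d (hx0 _ (subset_span (by simp)))
      (hx0 _ (subset_span (by simp))) (hx0 _ (subset_span (by simp)))
      (hx0 _ (subset_span (by simp)))
    simp
  refine h.isBase_iff.2 ⟨?_, hfr, hnd, ⟨span K {e₁, e₂}, ?_,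
    TS.span_pair h.symm H.e₁_mem H.e₂_mem H.e₁e₁ H.e₂e₂ H.e₁e₂, ?_⟩, fun U hU hts => ?_⟩
  · rw [span_le]
    rintro x (rfl | rfl | rfl | rfl)
    exacts [H.e₁_mem, H.e₂_mem, H.f₁_mem, H.f₂_mem]
  · refine span_mono ?_
    rintro x (rfl | rfl) <;> simp
  · refine finrank_span_pair_eq_two (β := β) (z := f₂) ?_ H.e₁f₂ H.e₂f₂
    rintro rfl
    simp at h1
  · have := hnd.two_mul_finrank_le h.two_ne h.symm hU hts
    omega

/-- Adding a multiple of a singular vector makes a vector singular. -/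
theorem exists_singular_sub_smul {x u : V} (hu : β u u = 0) (hux : β u x ≠ 0) :
    ∃ c : K, β (x - c • u) (x - c • u) = 0 := by
  -- The square of `x - c • u` is `β x x - 2 * c * β u x`, linear in `c`.
  refine ⟨β x x / (2 * β u x), ?_⟩
  have := h.two_ne
  simp only [map_sub, map_smul, LinearMap.sub_apply, LinearMap.smul_apply, smul_eq_mul, hu,
    h.symm x u]
  field_simp
  ring

theorem exists_hyperbolic_pair [FiniteDimensional K V] {d w : ℕ} {D : Submodule K V}
    (hD : IsBase T B q d w D) : ∃ u ∈ D, ∃ v ∈ D, β u u = 0 ∧ β v v = 0 ∧ β u v ≠ 0 := by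
  obtain ⟨-, -, hnd, ⟨U, hU, hts, hf⟩, -⟩ := h.isBase_iff.1 hD
  obtain ⟨u, huU, hu0⟩ := U.exists_mem_ne_zero_of_ne_bot (by
    rintro rfl
    rw [finrank_bot] at hf
    omega)
  have : ∃ v ∈ D, β u v ≠ 0 := by
    by_contra! hc
    exact hu0 (hnd u (hU huU) hc)
  obtain ⟨v, hv, huv⟩ := this
  have huu := (hts u huU).2
  obtain ⟨c, hc⟩ := h.exists_singular_sub_smul huu huv
  exact ⟨u, hU huU, _, D.sub_mem hv (D.smul_mem c (hU huU)), huu, hc, by simpa [huu] using huv⟩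

/-- Gram–Schmidt starting from a basis `e₁`, `e₂` of a totally singular plane `U` of `D`, with each
dual vector made singular at the end by `exists_singular_sub_smul`. -/
theorem exists_isHyperbolic [FiniteDimensional K V] {D : Submodule K V}
    (hD : IsBase T B q 2 1 D) :
    ∃ e₁ e₂ f₁ f₂, IsHyperbolic T B β e₁ e₂ f₁ f₂ ∧ D = span K {e₁, e₂, f₁, f₂} := by
  obtain ⟨hW, hfr, hnd, ⟨U, hU, hts, hf⟩, -⟩ := h.isBase_iff.1 hD
  have hex : ∀ x ∈ D, x ≠ 0 → ∃ y ∈ D, β x y ≠ 0 := by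
    intro x hx hx0
    by_contra! hc
    exact hx0 (hnd x hx hc)
  obtain ⟨e₁, he₁U, he₁0⟩ := U.exists_mem_ne_zero_of_ne_bot (by
    rintro rfl
    rw [finrank_bot] at hf
    omega)
  have hlt : ¬U ≤ K ∙ e₁ := fun hle => by
    have h1 := finrank_mono hle
    rw [finrank_span_singleton he₁0] at h1
    omega
  obtain ⟨e', he'U, he'⟩ := SetLike.not_le_iff_exists.1 hlt
  have he₁ := hU he₁U
  obtain ⟨g, hg, hg0⟩ := hex e₁ he₁ he₁0
  -- The second basis vector of `U` is chosen orthogonal to `g`, the future `f₁`.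
  set c := β e' g / β e₁ g with hc
  have he₂U : e' - c • e₁ ∈ U := U.sub_mem he'U (U.smul_mem c he₁U)
  have he₂0 : e' - c • e₁ ≠ 0 := fun h0 =>
    he' (mem_span_singleton.2 ⟨c, (sub_eq_zero.1 h0).symm⟩)
  have he₂g : β (e' - c • e₁) g = 0 := by
    simp [hc, hg0]
  generalize e' - c • e₁ = e₂ at he₂U he₂0 he₂g
  have he₂ := hU he₂U
  have e11 := (hts e₁ he₁U).2
  have e22 := (hts e₂ he₂U).2
  have e12 : β e₁ e₂ = 0 := hts.apply_eq_zero h.two_ne h.symm he₁U he₂U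
  have e21 : β e₂ e₁ = 0 := by rw [h.symm, e12]
  obtain ⟨s, hs⟩ := h.exists_singular_sub_smul e11 hg0
  have hf₁ : g - s • e₁ ∈ D := D.sub_mem hg (D.smul_mem s he₁)
  have e1f1 : β e₁ (g - s • e₁) ≠ 0 := by simpa [e11] using hg0
  have e2f1 : β e₂ (g - s • e₁) = 0 := by simp [e21, he₂g]
  generalize g - s • e₁ = f₁ at hs hf₁ e1f1 e2f1
  obtain ⟨k, hk, hk0⟩ := hex e₂ he₂ he₂0
  have f1e1 : β f₁ e₁ ≠ 0 := by rwa [h.symm]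
  have f1e2 : β f₁ e₂ = 0 := by rwa [h.symm]
  -- The part of `k` orthogonal to `e₁` and `f₁`. Its pairing with `e₂` is that of `k`, since `e₂`
  -- is orthogonal to both.
  set k' := k - (β f₁ k / β f₁ e₁) • e₁ - (β e₁ k / β e₁ f₁) • f₁ with hk'
  have hk'D : k' ∈ D := D.sub_mem (D.sub_mem hk (D.smul_mem _ he₁)) (D.smul_mem _ hf₁)
  have hk1 : β e₁ k' = 0 := by
    simp [hk', e11, e1f1]
  have hk2 : β f₁ k' = 0 := by
    simp [hk', hs, f1e1]
  have hk3 : β e₂ k' ≠ 0 := by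
    simpa [hk', e21, e2f1] using hk0
  clear_value k'
  obtain ⟨r, hr⟩ := h.exists_singular_sub_smul e22 hk3
  have H : IsHyperbolic T B β e₁ e₂ f₁ (k' - r • e₂) :=
    ⟨hW he₁, hW he₂, hW hf₁, hW (D.sub_mem hk'D (D.smul_mem r he₂)), e11, e22, hs, hr, e12,
      by simp [hk2, f1e2], by simp [hk1, e12], e2f1, e1f1, by simpa [e22] using hk3⟩
  refine ⟨e₁, e₂, f₁, _, H, ?_⟩
  refine (eq_of_le_of_finrank_eq ?_ ?_).symm
  · rw [span_le]
    rintro x (rfl | rfl | rfl | rfl)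
    exacts [he₁, he₂, hf₁, D.sub_mem hk'D (D.smul_mem r he₂)]
  · rw [hfr, (h.isBase_iff.1 (h.isBase_span_quadruple H)).2.1]

/-- Totally singular subspaces are spanned by their points, unless they lie in the vertex. -/
theorem sec_subset_iff_of_TS {U F : Submodule K V} (hU : TS β (T ⊔ B) U) (hT : ¬U ≤ T) :
    sec T B q U ⊆ sec T B q F ↔ U ≤ F := by
  rw [h.sec_subset_iff]
  refine ⟨fun H x hx => ?_, fun H v _ _ _ hv => H hv⟩
  obtain ⟨v, hv, hvT⟩ := SetLike.not_le_iff_exists.1 hT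
  have hvF := H v (hU v hv).1 (hU v hv).2 hvT hv
  -- Vectors of `T` give no points of the section, but such an `x` is the difference of `v + x` and
  -- `v`, both outside `T`.
  by_cases hxT : x ∈ T
  · have hvx : v + x ∉ T := fun hc => hvT (by simpa using T.sub_mem hc hxT)
    have h1 := U.add_mem hv hx
    simpa using F.sub_mem (H _ (hU _ h1).1 (hU _ h1).2 hvx h1) hvF
  · exact H x (hU x hx).1 (hU x hx).2 hxT hx

/-- A nondegenerate nonempty quadric spans its subspace. -/
theorem sec_subset_iff_of_isBase [FiniteDimensional K V] {d w : ℕ} {D F : Submodule K V}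
    (hD : IsBase T B q d w D) : sec T B q D ⊆ sec T B q F ↔ D ≤ F := by
  rw [h.sec_subset_iff]
  refine ⟨fun H x hx => ?_, fun H v _ _ _ hv => H hv⟩
  have hW := hD.1
  obtain ⟨u, hu, v, hv, huu, hvv, huv⟩ := h.exists_hyperbolic_pair hD
  have hvu : β v u ≠ 0 := by rwa [h.symm]
  have huF : u ∈ F := H u (hW hu) huu (fun hT => huv (h.vertex_left u hT v)) hu
  have hvF : v ∈ F := H v (hW hv) hvv (fun hT => huv (h.vertex_right hT)) hv
  -- The part of `x` orthogonal to the hyperbolic pair `u`, `v`. It may be nonsingular, but `y + u`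
  -- pairs nontrivially with `v`, so a multiple of `v` corrects it to a singular vector.
  set y := x - (β x v / β u v) • u - (β x u / β v u) • v with hy
  have hyD : y ∈ D := D.sub_mem (D.sub_mem hx (D.smul_mem _ hu)) (D.smul_mem _ hv)
  have hyu : β y u = 0 := by simp [hy, huu, hvu]
  have hyv : β y v = 0 := by simp [hy, hvv, huv]
  obtain ⟨c, hc⟩ := h.exists_singular_sub_smul (x := y + u) hvv
    (by simpa [h.symm v y, hyv] using hvu)
  have hs : y + u - c • v ∈ F := by
    refine H _ (hW ?_) hc (fun hT => huv ?_) ?_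
    · exact D.sub_mem (D.add_mem hyD hu) (D.smul_mem c hv)
    · simpa [hyv, hvv] using h.vertex_left _ hT v
    · exact D.sub_mem (D.add_mem hyD hu) (D.smul_mem c hv)
  have hyF : y ∈ F := by
    have h1 := F.sub_mem (F.add_mem hs (F.smul_mem c hvF)) huF
    simpa using h1
  have h1 := F.add_mem (F.add_mem hyF (F.smul_mem (β x u / β v u) hvF))
    (F.smul_mem (β x v / β u v) huF)
  simpa [hy] using h1

/-- With `m = 0` and `m' = w` both vertices `A` and `R` vanish. This covers cycles, Möbius planes
and Minkowski planes. -/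
theorem mem_coneClass_iff_isBase [FiniteDimensional K V] {d w : ℕ} {Z : Set (ℙ K V)} :
    Z ∈ coneClass T B q 0 w d w ↔ ∃ D, IsBase T B q d w D ∧ Z = sec T B q D := by
  constructor
  · rintro ⟨A, R, D, -, hA, -, hR, hD, -, -, rfl⟩
    obtain rfl : A = ⊥ := finrank_eq_zero.1 hA
    obtain rfl : R = ⊥ := finrank_eq_zero.1 (by omega)
    exact ⟨D, hD, by simp [sec]⟩
  · rintro ⟨D, hD, rfl⟩
    refine ⟨⊥, ⊥, D, by simp, by simp, by simp, by simp, hD, by simp, ?_, by simp [sec]⟩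
    intro x hx y hy
    rw [h.conjugate_iff, (mem_bot K).1 hx]
    exact ⟨zero_mem _, hD.1 (by simpa using hy), by simp⟩

theorem isConeOver_notMem {a : V} {D : Submodule K V} (H : IsConeOver T B q β a D) : a ∉ D :=
  fun ha => H.ne_zero ((h.isBase_iff.1 H.base).2.2.1 a ha H.orth)

/-- Affine and projective cones differ only in whether the vertex `a` lies in `T`; being orthogonal
to `D` is automatic in the first case and imposed in the second. -/
theorem mem_cones_iff [FiniteDimensional K V] {Z : Set (ℙ K V)} :
    Z ∈ affCones T B q ∪ projCones T B q ↔
      ∃ a D, IsConeOver T B q β a D ∧ Z = sec T B q (K ∙ a ⊔ D) := by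
  constructor
  · rintro (⟨A, R, D, hAT, hA, -, hR, hD, -, -, rfl⟩ | ⟨A, R, D, -, hA, hRT, hR, hD, -, hc, rfl⟩)
    · obtain rfl : R = ⊥ := finrank_eq_zero.1 (by omega)
      obtain ⟨a, ha, rfl⟩ := exists_eq_span_singleton hA
      have haT := hAT (mem_span_singleton_self a)
      exact ⟨a, D, ⟨ha, mem_sup_left haT, h.vertex_left a haT a, hD,
        fun y _ => h.vertex_left a haT y⟩, by simp [sec]⟩
    · obtain rfl : A = ⊥ := finrank_eq_zero.1 hA
      obtain ⟨a, ha, rfl⟩ := exists_eq_span_singleton hR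
      have haa := mem_span_singleton_self (R := K) a
      have hc' := fun y hy => (h.conjugate_iff a y).1 (hc a haa y hy)
      exact ⟨a, D, ⟨ha, (hc' a (mem_sup_left haa)).1, (hc' a (mem_sup_left haa)).2.2, hD,
        fun y hy => (hc' y (mem_sup_right hy)).2.2⟩, by simp [sec]⟩
  · rintro ⟨a, D, H, rfl⟩
    have hdis : Disjoint (K ∙ a) D := by
      exact ((disjoint_span_singleton' H.ne_zero).2 (h.isConeOver_notMem H)).symm
    by_cases haT : a ∈ T
    · left
      refine ⟨K ∙ a, ⊥, D, by simpa [span_singleton_le_iff_mem], finrank_span_singleton H.ne_zero,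
        by simp, by simp, H.base, by simpa using hdis, ?_, by simp [sec]⟩
      intro x hx y hy
      rw [h.conjugate_iff, (mem_bot K).1 hx]
      exact ⟨zero_mem _, H.base.1 (by simpa using hy), by simp⟩
    · right
      refine ⟨⊥, K ∙ a, D, by simp, by simp, ?_, ?_, H.base, by simpa using hdis, ?_, by simp [sec]⟩
      · exact ((disjoint_span_singleton' H.ne_zero).2 haT).symm
      · rw [finrank_span_singleton H.ne_zero]
      · intro x hx y hy
        obtain ⟨c, rfl⟩ := mem_span_singleton.1 hx
        obtain ⟨z, hz, y, hyD, rfl⟩ := mem_sup.1 hy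
        obtain ⟨d, rfl⟩ := mem_span_singleton.1 hz
        exact (h.conjugate_iff _ _).2 ⟨smul_mem _ _ H.mem, add_mem (smul_mem _ _ H.mem)
          (H.base.1 hyD), by simp [H.singular, H.orth y hyD]⟩

end IsPolar

end Laguerre

/-! ### 2-subspaces through two given 1-subspaces -/

namespace Laguerre

open Module Submodule

variable {K V : Type*} [Field K] [AddCommGroup V] [Module K V]

/-- The ruling line is a totally singular plane, at most half of the nondegenerate space `B`. -/
theorem four_le_finrank [FiniteDimensional K V] (hK : (2 : K) ≠ 0) {T B : Submodule K V}
    (hTB : Disjoint T B) {q : QuadraticForm K B} (hq : (QuadraticMap.polarBilin q).Nondegenerate)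
    (hruled : Ruled q) :
    4 ≤ finrank K B ∧
      finrank K (T ⊔ B : Submodule K V) = finrank K T + finrank K B := by
  obtain ⟨U, hU, h0⟩ := hruled
  have h1 : Nondeg (QuadraticMap.polarBilin q) ⊤ := fun x _ hx => hq.1 x fun y => hx y mem_top
  have h2 := h1.two_mul_finrank_le (W := ⊤) hK (fun x y => QuadraticMap.polar_comm q x y)
    (le_top : U ≤ ⊤) (fun v hv => ⟨mem_top, by simp [QuadraticMap.polar_self, h0 v hv]⟩)
  have h3 := finrank_sup_add_finrank_inf_eq T B
  rw [hTB.eq_bot, finrank_bot] at h3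
  rw [finrank_top] at h2
  omega

namespace IsPolar

variable {T B : Submodule K V} {q : QuadraticForm K B} {β : LinearMap.BilinForm K V}

theorem exists_TS_of_ruled (h : IsPolar T B q β) (hruled : Ruled q) :
    ∃ U, TS β (T ⊔ B) U ∧ finrank K U = 2 := by
  obtain ⟨U, hU, h0⟩ := hruled
  refine ⟨U.map B.subtype, h.totallySingular_iff.1 ?_, by rw [finrank_map_subtype_eq, hU]⟩
  rintro _ ⟨b, hb, rfl⟩
  exact ⟨0, T.zero_mem, b, by simp, h0 b hb⟩

variable (h : IsPolar T B q β) [FiniteDimensional K V]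
include h

omit [FiniteDimensional K V] in
theorem mem_subspaces2_cases {Z : Set (ℙ K V)} (hZ : Z ∈ subspaces2 T B q) :
    (∃ E, TS β (T ⊔ B) E ∧ finrank K E = 3 ∧ ¬E ≤ T ∧ Z = sec T B q E) ∨
    Z ∈ affCones T B q ∪ projCones T B q ∨ Z ∈ mobiusPlanes T B q ∨
    Z ∈ minkowskiPlanes T B q := by
  have hgen : ∀ m d, m + d + 1 = 3 → Z ∈ generatorClass T B q m d →
      ∃ E, TS β (T ⊔ B) E ∧ finrank K E = 3 ∧ ¬E ≤ T ∧ Z = sec T B q E := by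
    rintro m d hmd ⟨E, hE, hf, hm, rfl⟩
    refine ⟨E, h.totallySingular_iff.1 hE, by omega, fun hT => ?_, rfl⟩
    rw [inf_eq_left.2 hT] at hm
    omega
  rcases hZ with (((((hZ | hZ) | hZ) | hZ) | hZ) | hZ) | hZ
  · exact Or.inl (hgen 0 2 rfl hZ)
  · exact Or.inl (hgen 1 1 rfl hZ)
  · exact Or.inl (hgen 2 0 rfl hZ)
  · exact Or.inr (Or.inl (Or.inl hZ))
  · exact Or.inr (Or.inl (Or.inr hZ))
  · exact Or.inr (Or.inr (Or.inl hZ))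
  · exact Or.inr (Or.inr (Or.inr hZ))

omit [FiniteDimensional K V] in
omit h in
theorem cones_subset_subspaces2 {Z : Set (ℙ K V)}
    (hZ : Z ∈ affCones T B q ∪ projCones T B q) : Z ∈ subspaces2 T B q := by
  rcases hZ with hZ | hZ <;> simp [subspaces2, hZ]

theorem finrank_cone {a : V} {D : Submodule K V} (H : IsConeOver T B q β a D) :
    finrank K (K ∙ a ⊔ D : Submodule K V) = 4 := by
  have h1 := finrank_sup_add_finrank_inf_eq (K ∙ a) D
  have h2 := ((disjoint_span_singleton' H.ne_zero).2 (h.isConeOver_notMem H)).symm.eq_bot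
  rw [h2, finrank_bot, finrank_span_singleton H.ne_zero, H.base.2.1] at h1
  omega

omit h [FiniteDimensional K V] in
theorem apply_cone {a : V} {D : Submodule K V} (H : IsConeOver T B q β a D) {x : V}
    (hx : x ∈ K ∙ a ⊔ D) : β a x = 0 := by
  obtain ⟨z, hz, y, hy, rfl⟩ := mem_sup.1 hx
  obtain ⟨c, rfl⟩ := mem_span_singleton.1 hz
  simp [H.singular, H.orth y hy]

/-- `D` is a hyperplane of the cone's span and has index `0`, so `E` meets `D` in dimension at most
one. -/
theorem finrank_le_two_of_le_cone {a : V} {D E : Submodule K V} (H : IsConeOver T B q β a D)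
    (hE : E ≤ K ∙ a ⊔ D) (hts : TS β (T ⊔ B) E) : finrank K E ≤ 2 := by
  have h1 := finrank_sup_add_finrank_inf_eq E D
  have h2 := (h.isBase_iff.1 H.base).2.2.2.2 (E ⊓ D) inf_le_right (hts.mono inf_le_left)
  have h3 := finrank_mono (sup_le hE le_sup_right : E ⊔ D ≤ K ∙ a ⊔ D)
  have h4 := H.base.2.1
  rw [h.finrank_cone H] at h3
  omega

/-- Otherwise adjoining `a`, which is singular and orthogonal to the whole cone, would give a
totally singular subspace of dimension three. -/
theorem vertex_mem_of_le_cone {a : V} {D U : Submodule K V} (H : IsConeOver T B q β a D)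
    (hU : U ≤ K ∙ a ⊔ D) (hts : TS β (T ⊔ B) U) (hf : finrank K U = 2) : a ∈ U := by
  by_contra ha
  have h1 : U < U ⊔ K ∙ a := by
    refine lt_of_le_of_ne le_sup_left fun heq => ha ?_
    rw [heq]
    exact mem_sup_right (mem_span_singleton_self a)
  have h2 := finrank_lt_finrank_of_lt h1
  have h3 := h.finrank_le_two_of_le_cone H (sup_le hU le_sup_left)
    (hts.sup (TS.span_singleton H.mem H.singular) h.symm fun x hx y hy => by
      obtain ⟨c, rfl⟩ := mem_span_singleton.1 hy
      rw [map_smul, h.symm, apply_cone H (hU hx), smul_zero])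
  omega

/-- A 2-subspace is the section by a totally singular subspace of dimension three, or by a
four-dimensional subspace without such subspaces. -/
theorem exists_eq_sec {Z : Set (ℙ K V)} (hZ : Z ∈ subspaces2 T B q) :
    ∃ F, Z = sec T B q F ∧ ((finrank K F = 3 ∧ TS β (T ⊔ B) F ∧ ¬F ≤ T) ∨
      (finrank K F = 4 ∧ ∀ U ≤ F, TS β (T ⊔ B) U → finrank K U ≤ 2)) := by
  rcases h.mem_subspaces2_cases hZ with ⟨E, hts, hf, hT, rfl⟩ | hZ | hZ | hZ
  · exact ⟨E, rfl, Or.inl ⟨hf, hts, hT⟩⟩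
  · obtain ⟨a, D, H, rfl⟩ := h.mem_cones_iff.1 hZ
    exact ⟨_, rfl, Or.inr ⟨h.finrank_cone H, fun U hU => h.finrank_le_two_of_le_cone H hU⟩⟩
  · obtain ⟨D, hD, rfl⟩ := h.mem_coneClass_iff_isBase.1 hZ
    have hD' := h.isBase_iff.1 hD
    exact ⟨_, rfl, Or.inr ⟨hD.2.1, fun U hU ht => (hD'.2.2.2.2 U hU ht).trans (by norm_num)⟩⟩
  · obtain ⟨D, hD, rfl⟩ := h.mem_coneClass_iff_isBase.1 hZ
    have hD' := h.isBase_iff.1 hD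
    exact ⟨_, rfl, Or.inr ⟨hD.2.1, hD'.2.2.2.2⟩⟩

omit h in
theorem lt_finrank_sup {U U' : Submodule K V} (hne : U ≠ U') (hf : finrank K U = finrank K U') :
    finrank K U < finrank K (U ⊔ U' : Submodule K V) := by
  refine finrank_lt_finrank_of_lt (lt_of_le_of_ne le_sup_left fun heq => hne ?_)
  exact (eq_of_le_of_finrank_eq (heq ▸ le_sup_right) hf.symm).symm

/-- Two distinct lines of a plane lie in no other 2-subspace. -/
theorem eq_sec_plane {E U U' : Submodule K V} {Z : Set (ℙ K V)} (hE : TS β (T ⊔ B) E)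
    (hf : finrank K E = 3) (hUE : U ≤ E) (hUE' : U' ≤ E) (hU : finrank K U = 2)
    (hU' : finrank K U' = 2) (hT : ¬U ≤ T) (hT' : ¬U' ≤ T) (hne : U ≠ U')
    (hZ : Z ∈ subspaces2 T B q) (h1 : sec T B q U ⊆ Z) (h2 : sec T B q U' ⊆ Z) :
    Z = sec T B q E := by
  obtain ⟨F, rfl, hF⟩ := h.exists_eq_sec hZ
  have h3 := (h.sec_subset_iff_of_TS (hE.mono hUE) hT).1 h1
  have h4 := (h.sec_subset_iff_of_TS (hE.mono hUE') hT').1 h2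
  have h5 := lt_finrank_sup hne (hU.trans hU'.symm)
  have h6 : U ⊔ U' = E := eq_of_le_of_finrank_le (sup_le hUE hUE') (by omega)
  have hEF : E ≤ F := h6 ▸ sup_le h3 h4
  rcases hF with ⟨hF, -⟩ | ⟨-, hF⟩
  · rw [eq_of_le_of_finrank_eq hEF (hf.trans hF.symm)]
  · have := hF E hEF hE
    omega

/-- No 2-subspace comes from a subspace of dimension above four, so lines whose span contains `F`
leave no choice. -/
theorem eq_sec_of_le {F U U' : Submodule K V} {Z : Set (ℙ K V)} (hf : finrank K F = 4)
    (hle : F ≤ U ⊔ U') (hU : TS β (T ⊔ B) U) (hU' : TS β (T ⊔ B) U') (hT : ¬U ≤ T) (hT' : ¬U' ≤ T)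
    (hZ : Z ∈ subspaces2 T B q) (h1 : sec T B q U ⊆ Z) (h2 : sec T B q U' ⊆ Z) :
    Z = sec T B q F := by
  obtain ⟨F', rfl, hF⟩ := h.exists_eq_sec hZ
  have h3 := (h.sec_subset_iff_of_TS hU hT).1 h1
  have h4 := (h.sec_subset_iff_of_TS hU' hT').1 h2
  have hle' := hle.trans (sup_le h3 h4)
  have h5 := finrank_mono hle'
  rw [eq_of_le_of_finrank_le hle' (by omega)]

/-- The orthogonal complement of a conic contains a nonsingular vector. -/
theorem exists_orthogonal_nonsingular {D : Submodule K V} (hD : IsBase T B q 1 0 D)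
    (hdim : finrank K T + 4 ≤ finrank K (T ⊔ B : Submodule K V)) :
    ∃ w ∈ T ⊔ B, (∀ y ∈ D, β w y = 0) ∧ β w w ≠ 0 := by
  by_contra! hc
  obtain ⟨hW, hf, hnd, -⟩ := h.isBase_iff.1 hD
  -- If `N` had only singular vectors, it would be orthogonal to itself and to `D`, hence to `T ⊔ B
  -- = D + N`. Then `N ≤ T`, and `T ⊔ B` would have dimension at most `finrank T + 3`.
  let N : Submodule K V := (T ⊔ B) ⊓ β.orthogonal D
  have hN : ∀ n, n ∈ N ↔ n ∈ T ⊔ B ∧ ∀ y ∈ D, β n y = 0 := fun n => by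
    rw [mem_inf]
    exact and_congr_right fun _ => forall₂_congr fun y _ => by
      rw [h.symm]
  have hts : TS β (T ⊔ B) N := fun n hn => ⟨hn.1, hc n hn.1 ((hN n).1 hn).2⟩
  have hsplit : ∀ x ∈ T ⊔ B, ∃ d ∈ D, x - d ∈ N := fun x hx => by
    obtain ⟨d, hd, hxd⟩ := hnd.exists_sub_orthogonal h.symm x
    exact ⟨d, hd, (hN _).2 ⟨sub_mem hx (hW hd), hxd⟩⟩
  have hNT : N ≤ T := fun n hn => h.radical n hn.1 fun y hy => by
    obtain ⟨d, hd, hyd⟩ := hsplit y hy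
    have h1 := hts.apply_eq_zero h.two_ne h.symm hn hyd
    rw [map_sub, ((hN n).1 hn).2 d hd, sub_zero] at h1
    exact h1
  have hle : T ⊔ B ≤ D ⊔ T := fun x hx => by
    obtain ⟨d, hd, hxd⟩ := hsplit x hx
    simpa using add_mem_sup hd (hNT hxd)
  have h1 := finrank_mono hle
  have h2 := finrank_add_le_finrank_add_finrank D T
  omega

theorem mem_subspaces2_of_isHyperbolic {e₁ e₂ f₁ f₂ : V} (H : IsHyperbolic T B β e₁ e₂ f₁ f₂) :
    sec T B q (span K {e₁, e₂, f₁, f₂}) ∈ subspaces2 T B q :=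
  Or.inr (h.mem_coneClass_iff_isBase.2 ⟨_, h.isBase_span_quadruple H, rfl⟩)

theorem mem_subspaces2_of_isConeOver {a : V} {D : Submodule K V} (H : IsConeOver T B q β a D) :
    sec T B q (K ∙ a ⊔ D) ∈ subspaces2 T B q :=
  cones_subset_subspaces2 (h.mem_cones_iff.2 ⟨a, D, H, rfl⟩)

omit h [FiniteDimensional K V] in
theorem isConeOver_span_triple {a u v w : V} (ha0 : a ≠ 0) (ha : a ∈ T ⊔ B) (haa : β a a = 0)
    (hau : β a u = 0) (hav : β a v = 0) (haw : β a w = 0)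
    (hD : IsBase T B q 1 0 (span K {u, v, w})) :
    IsConeOver T B q β a (span K {u, v, w}) := by
  refine ⟨ha0, ha, haa, hD, fun y hy => ?_⟩
  obtain ⟨r, s, t, rfl⟩ := mem_span_triple.1 hy
  simp [hau, hav, haw]

omit h [FiniteDimensional K V] in
theorem sec_mono {F F' : Submodule K V} (hle : F ≤ F') : sec T B q F ⊆ sec T B q F' :=
  Set.inter_subset_inter_right _ fun _ hp => le_trans hp hle

/-- Two distinct lines of a cone lie in another 2-subspace. -/
theorem exists_ne_sec_cone (hdim : finrank K T + 4 ≤ finrank K (T ⊔ B : Submodule K V))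
    {a : V} {D U U' : Submodule K V} (H : IsConeOver T B q β a D) (hU : U ≤ K ∙ a ⊔ D)
    (hU' : U' ≤ K ∙ a ⊔ D) (hts : TS β (T ⊔ B) U) (hts' : TS β (T ⊔ B) U')
    (hf : finrank K U = 2) (hf' : finrank K U' = 2) (hne : U ≠ U') :
    ∃ Z ∈ subspaces2 T B q, sec T B q U ⊆ Z ∧ sec T B q U' ⊆ Z ∧ Z ≠ sec T B q (K ∙ a ⊔ D) := by
  have haU := h.vertex_mem_of_le_cone H hU hts hf
  have haU' := h.vertex_mem_of_le_cone H hU' hts' hf'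
  -- Were the two lines orthogonal, their sum would be a totally singular subspace of dimension
  -- three in the cone.
  have huv : ∃ u ∈ U, ∃ v ∈ U', β u v ≠ 0 := by
    by_contra! hc
    have h1 := h.finrank_le_two_of_le_cone H (sup_le hU hU') (hts.sup hts' h.symm hc)
    have h2 := lt_finrank_sup hne (hf.trans hf'.symm)
    omega
  obtain ⟨u, hu, v, hv, huv⟩ := huv
  have hvu : β v u ≠ 0 := by rwa [h.symm]
  have hau := apply_cone H (hU hu)
  have hav := apply_cone H (hU' hv)
  have huu := (hts u hu).2
  have hvv := (hts' v hv).2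
  have hspan : U = span K {a, u} := by
    refine (eq_of_le_of_finrank_eq ?_ ?_).symm
    · rw [span_le]
      rintro x (rfl | rfl) <;> assumption
    · rw [hf, finrank_span_pair_eq_two H.ne_zero hav huv]
  have hspan' : U' = span K {a, v} := by
    refine (eq_of_le_of_finrank_eq ?_ ?_).symm
    · rw [span_le]
      rintro x (rfl | rfl) <;> assumption
    · rw [hf', finrank_span_pair_eq_two H.ne_zero hau hvu]
  have hUF : ∀ F : Submodule K V, a ∈ F → u ∈ F → U ≤ F := fun F h1 h2 => by
    rw [hspan, span_le]
    rintro x (rfl | rfl) <;> assumption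
  have hUF' : ∀ F : Submodule K V, a ∈ F → v ∈ F → U' ≤ F := fun F h1 h2 => by
    rw [hspan', span_le]
    rintro x (rfl | rfl) <;> assumption
  by_cases haT : a ∈ T
  -- Affine cone: keep the vertex and replace the conic by the one in the span of `u`, `v`, `w`. The
  -- nonsingular `w` is orthogonal to the old cone's span, so lies outside it.
  · obtain ⟨w, hw, hwD, hww⟩ := h.exists_orthogonal_nonsingular H.base hdim
    have hwF : ∀ x ∈ K ∙ a ⊔ D, β w x = 0 := fun x hx => by
      obtain ⟨z, hz, y, hy, rfl⟩ := mem_sup.1 hx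
      obtain ⟨c, rfl⟩ := mem_span_singleton.1 hz
      simp [hwD y hy, h.vertex_right haT]
    have hbase := h.isBase_span_triple (hts u hu).1 (hts' v hv).1 hw huu hvv huv
      (hwF u (hU hu)) (hwF v (hU' hv)) hww
    have hcone := isConeOver_span_triple H.ne_zero H.mem H.singular hau hav
      (h.vertex_left a haT w) hbase
    refine ⟨_, h.mem_subspaces2_of_isConeOver hcone, sec_mono (hUF _ ?_ ?_),
      sec_mono (hUF' _ ?_ ?_), fun heq => ?_⟩
    · exact mem_sup_left (mem_span_singleton_self a)
    · exact mem_sup_right (subset_span (by simp))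
    · exact mem_sup_left (mem_span_singleton_self a)
    · exact mem_sup_right (subset_span (by simp))
    · have h1 := (h.sec_subset_iff_of_isBase hbase).1 ((sec_mono le_sup_right).trans heq.subset)
      exact hww (hwF w (h1 (subset_span (by simp))))
  · have hex : ∃ w ∈ T ⊔ B, β a w ≠ 0 := by
      by_contra! hc
      exact haT (h.radical a H.mem hc)
    obtain ⟨w, hw, haw⟩ := hex
    -- Projective cone: `w₁` is `w` made orthogonal to `u` and `v`. Corrected by a multiple of `a`,
    -- it completes `a`, `u`, `v` to a hyperbolic basis, so the two lines lie in a Minkowski plane.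
    set w₁ := w - (β w v / β u v) • u - (β w u / β v u) • v with hw₁
    have hw₁W : w₁ ∈ T ⊔ B :=
      sub_mem (sub_mem hw (smul_mem _ _ (hts u hu).1)) (smul_mem _ _ (hts' v hv).1)
    have haw₁ : β a w₁ ≠ 0 := by simpa [hw₁, hau, hav] using haw
    have hw₁u : β w₁ u = 0 := by simp [hw₁, huu, hvu]
    have hw₁v : β w₁ v = 0 := by simp [hw₁, hvv, huv]
    clear_value w₁
    obtain ⟨c, hc⟩ := h.exists_singular_sub_smul H.singular haw₁
    have haw₂ : β a (w₁ - c • a) ≠ 0 := by simpa [H.singular] using haw₁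
    have hw₂W : w₁ - c • a ∈ T ⊔ B := sub_mem hw₁W (smul_mem _ _ H.mem)
    have hhyp : IsHyperbolic T B β a u (w₁ - c • a) v :=
      ⟨H.mem, (hts u hu).1, hw₂W, (hts' v hv).1, H.singular, huu, hc, hvv, hau,
        by simp [hw₁v, hav], hav, by simp [h.symm u, hw₁u, hau], haw₂, huv⟩
    refine ⟨_, h.mem_subspaces2_of_isHyperbolic hhyp, sec_mono (hUF _ ?_ ?_),
      sec_mono (hUF' _ ?_ ?_), fun heq => ?_⟩
    · exact subset_span (by simp)
    · exact subset_span (by simp)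
    · exact subset_span (by simp)
    · exact subset_span (by simp)
    · have h1 := h.sec_subset_iff.1 heq.subset _ hw₂W hc (fun hT => haw₂ (h.vertex_right hT))
        (subset_span (by simp))
      exact haw₂ (apply_cone H h1)

/-- Two intersecting lines of a Minkowski plane lie in another 2-subspace. -/
theorem exists_ne_sec_hyperbolic (hdim : 5 ≤ finrank K (T ⊔ B : Submodule K V))
    {e₁ e₂ f₁ f₂ : V} (H : IsHyperbolic T B β e₁ e₂ f₁ f₂) :
    ∃ Z ∈ subspaces2 T B q, sec T B q (span K {e₁, e₂}) ⊆ Z ∧ sec T B q (span K {e₁, f₂}) ⊆ Z ∧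
      Z ≠ sec T B q (span K {e₁, e₂, f₁, f₂}) := by
  have hbase := h.isBase_span_quadruple H
  obtain ⟨hW, hf, hnd, -⟩ := h.isBase_iff.1 hbase
  have hlt : ¬T ⊔ B ≤ span K {e₁, e₂, f₁, f₂} := fun hle => by
    have := finrank_mono hle
    omega
  obtain ⟨x, hx, hxD⟩ := SetLike.not_le_iff_exists.1 hlt
  obtain ⟨d, hd, hxd⟩ := hnd.exists_sub_orthogonal h.symm x
  have hwW : x - d ∈ T ⊔ B := sub_mem hx (hW hd)
  have hwD : x - d ∉ span K {e₁, e₂, f₁, f₂} := fun hc => hxD (by simpa using add_mem hc hd)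
  generalize x - d = w at hxd hwW hwD
  have hwe₁ : β w e₁ = 0 := hxd _ (subset_span (by simp))
  have hwe₂ : β w e₂ = 0 := hxd _ (subset_span (by simp))
  have hwf₁ : β w f₁ = 0 := hxd _ (subset_span (by simp))
  have hwf₂ : β w f₂ = 0 := hxd _ (subset_span (by simp))
  have he₁w : β e₁ w = 0 := by rwa [h.symm]
  have he₂w : β e₂ w = 0 := by rwa [h.symm]
  have hf₁w : β f₁ w = 0 := by rwa [h.symm]
  by_cases hww : β w w = 0
  -- A singular `w` orthogonal to everything in sight tilts the Minkowski plane about its two lines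
  -- through `e₁`.
  · have hhyp : IsHyperbolic T B β e₁ e₂ (f₁ + w) f₂ :=
      { H with
        f₁_mem := add_mem H.f₁_mem hwW
        f₁f₁ := by simp [H.f₁f₁, hwf₁, hf₁w, hww]
        f₁f₂ := by simp [H.f₁f₂, hwf₂]
        e₂f₁ := by simp [H.e₂f₁, he₂w]
        e₁f₁ := by simpa [he₁w] using H.e₁f₁ }
    refine ⟨_, h.mem_subspaces2_of_isHyperbolic hhyp, sec_mono (span_mono ?_),
      sec_mono (span_mono ?_), fun heq => hwD ?_⟩
    · rintro x (rfl | rfl) <;> simp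
    · rintro x (rfl | rfl) <;> simp
    · have h1 := h.sec_subset_iff.1 heq.subset _ hhyp.f₁_mem hhyp.f₁f₁
        (fun hT => hhyp.e₁f₁ (h.vertex_right hT)) (subset_span (by simp))
      have h2 : f₁ ∈ span K {e₁, e₂, f₁, f₂} := subset_span (by simp)
      simpa using sub_mem h1 h2
  -- For nonsingular `w` the two lines lie in the cone with vertex `e₁` over the conic in the span
  -- of `e₂`, `f₂`, `w`.
  · have hcb := h.isBase_span_triple H.e₂_mem H.f₂_mem hwW H.e₂e₂ H.f₂f₂ H.e₂f₂ hwe₂ hwf₂ hww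
    have hcone := isConeOver_span_triple (fun h0 => H.e₁f₁ (by simp [h0])) H.e₁_mem H.e₁e₁ H.e₁e₂
      H.e₁f₂ he₁w hcb
    refine ⟨_, h.mem_subspaces2_of_isConeOver hcone, sec_mono ?_, sec_mono ?_, fun heq => ?_⟩
    · rw [span_le]
      rintro x (rfl | rfl)
      · exact mem_sup_left (mem_span_singleton_self _)
      · exact mem_sup_right (subset_span (by simp))
    · rw [span_le]
      rintro x (rfl | rfl)
      · exact mem_sup_left (mem_span_singleton_self _)
      · exact mem_sup_right (subset_span (by simp))
    · have h1 := h.sec_subset_iff.1 heq.symm.subset _ H.f₁_mem H.f₁f₁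
        (fun hT => H.e₁f₁ (h.vertex_right hT)) (subset_span (by simp))
      exact H.e₁f₁ (apply_cone hcone h1)

/-- A cycle and another 1-subspace lie in at most one 2-subspace. -/
theorem mem_lines_of_subset {Y Y' Z Z' : Set (ℙ K V)} (hY : Y ∈ subspaces1 T B q)
    (hY' : Y' ∈ subspaces1 T B q) (hZ : Z ∈ subspaces2 T B q) (hZ' : Z' ∈ subspaces2 T B q)
    (hYY : Y ≠ Y') (hZZ : Z ≠ Z') (h1 : Y ⊆ Z) (h2 : Y' ⊆ Z) (h3 : Y ⊆ Z') (h4 : Y' ⊆ Z') :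
    Y ∈ lines T B q := by
  refine hY.resolve_left fun hY => ?_
  obtain ⟨D, hD, rfl⟩ := h.mem_coneClass_iff_isBase.1 hY
  have hD' := h.isBase_iff.1 hD
  have hfour : ∀ Z ∈ subspaces2 T B q, sec T B q D ⊆ Z →
      ∃ F, Z = sec T B q F ∧ finrank K F = 4 ∧ D ≤ F := by
    intro Z hZ hDZ
    obtain ⟨F, rfl, hF⟩ := h.exists_eq_sec hZ
    have hle := (h.sec_subset_iff_of_isBase hD).1 hDZ
    rcases hF with ⟨-, hF, -⟩ | ⟨hF, -⟩
    · have := hD'.2.2.2.2 D le_rfl (hF.mono hle)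
      have := hD.2.1
      omega
    · exact ⟨F, rfl, hF, hle⟩
  obtain ⟨F, rfl, hF, hDF⟩ := hfour Z hZ h1
  obtain ⟨F', rfl, hF', hDF'⟩ := hfour Z' hZ' h3
  -- `F` and `F'` are distinct of dimension four and contain `D` of dimension three, so they meet
  -- exactly in `D`.
  have hS : ∀ S : Submodule K V, S ≤ F → S ≤ F' → S ≤ D := by
    intro S hSF hSF'
    by_contra hc
    have hlt : D < D ⊔ S := lt_of_le_of_ne le_sup_left fun heq => hc (heq ▸ le_sup_right)
    have h5 := finrank_lt_finrank_of_lt hlt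
    have h6 := hD.2.1
    have h7 := eq_of_le_of_finrank_le (sup_le hDF hSF) (by omega)
    have h8 := eq_of_le_of_finrank_le (sup_le hDF' hSF') (by omega)
    exact hZZ (by rw [← h7, ← h8])
  rcases hY' with hY' | hY'
  · obtain ⟨S, hS', rfl⟩ := h.mem_coneClass_iff_isBase.1 hY'
    have hle := hS S ((h.sec_subset_iff_of_isBase hS').1 h2) ((h.sec_subset_iff_of_isBase hS').1 h4)
    exact hYY (by rw [eq_of_le_of_finrank_eq hle (hS'.2.1.trans hD.2.1.symm)])
  · obtain ⟨U, hU, hts, hT, rfl⟩ := h.mem_lines_iff.1 hY'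
    have hle := hS U ((h.sec_subset_iff_of_TS hts hT).1 h2) ((h.sec_subset_iff_of_TS hts hT).1 h4)
    have := hD'.2.2.2.2 U hle hts
    omega

end IsPolar

end Laguerre

/-! ### Criteria for cones and Minkowski planes -/

namespace Laguerre

open Module Submodule

variable {K V : Type*} [Field K] [AddCommGroup V] [Module K V]

namespace IsPolar

variable {T B : Submodule K V} {q : QuadraticForm K B} {β : LinearMap.BilinForm K V}

theorem _root_.Laguerre.IsHyperbolic.swap (h : IsPolar T B q β) {e₁ e₂ f₁ f₂ : V}
    (H : IsHyperbolic T B β e₁ e₂ f₁ f₂) : IsHyperbolic T B β f₁ f₂ e₁ e₂ :=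
  ⟨H.f₁_mem, H.f₂_mem, H.e₁_mem, H.e₂_mem, H.f₁f₁, H.f₂f₂, H.e₁e₁, H.e₂e₂, H.f₁f₂, H.e₁e₂,
    by rw [h.symm, H.e₂f₁], by rw [h.symm, H.e₁f₂], by rw [h.symm]; exact H.e₁f₁,
    by rw [h.symm]; exact H.e₂f₂⟩

theorem span_swap (e₁ e₂ f₁ f₂ : V) :
    span K {f₁, f₂, e₁, e₂} = span K {e₁, e₂, f₁, f₂} := by
  congr 1
  ext x
  simp only [Set.mem_insert_iff, Set.mem_singleton_iff]
  tauto

variable (h : IsPolar T B q β)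
include h

theorem sec_pair_mem_lines {e₁ e₂ f₁ f₂ : V} (H : IsHyperbolic T B β e₁ e₂ f₁ f₂) :
    sec T B q (span K {e₁, e₂}) ∈ lines T B q ∧ sec T B q (span K {e₁, f₂}) ∈ lines T B q := by
  have h0 : e₁ ≠ 0 := fun h0 => H.e₁f₁ (by simp [h0])
  exact ⟨h.sec_span_pair_mem_lines H.e₁_mem H.e₂_mem h0 H.e₁e₁ H.e₂e₂ H.e₁e₂ H.e₁f₂ H.e₂f₂,
    h.sec_span_pair_mem_lines H.e₁_mem H.f₂_mem h0 H.e₁e₁ H.f₂f₂ H.e₁f₂ H.e₁e₂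
      (by rw [h.symm]; exact H.e₂f₂)⟩

theorem sec_pair_ne {e₁ e₂ f₁ f₂ : V} (H : IsHyperbolic T B β e₁ e₂ f₁ f₂) :
    sec T B q (span K {e₁, e₂}) ≠ sec T B q (span K {e₁, f₂}) ∧
    sec T B q (span K {e₁, e₂}) ≠ sec T B q (span K {f₁, f₂}) := by
  have key : ∀ x, β x f₂ = 0 →
      sec T B q (span K {e₁, e₂}) ≠ sec T B q (span K {x, f₂}) := by
    intro x hx heq
    have h1 := h.sec_subset_iff.1 heq.subset _ H.e₂_mem H.e₂e₂
      (fun hT => H.e₂f₂ (h.vertex_left _ hT _)) (subset_span (by simp))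
    obtain ⟨a, b, hab⟩ := mem_span_pair.1 h1
    exact H.e₂f₂ (by simp [← hab, hx, H.f₂f₂])
  exact ⟨key _ H.e₁f₂, key _ H.f₁f₂⟩

variable [FiniteDimensional K V]

/-- Two skew lines of a Minkowski plane lie in no other 2-subspace. -/
theorem eq_sec_hyperbolic {e₁ e₂ f₁ f₂ : V} (H : IsHyperbolic T B β e₁ e₂ f₁ f₂)
    {Z : Set (ℙ K V)} (hZ : Z ∈ subspaces2 T B q) (h1 : sec T B q (span K {e₁, e₂}) ⊆ Z)
    (h2 : sec T B q (span K {f₁, f₂}) ⊆ Z) : Z = sec T B q (span K {e₁, e₂, f₁, f₂}) := by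
  have hT : ¬span K {e₁, e₂} ≤ T := fun hT =>
    H.e₁f₁ (h.vertex_left _ (hT (subset_span (by simp))) _)
  have hT' : ¬span K {f₁, f₂} ≤ T := fun hT =>
    H.e₁f₁ (h.vertex_right (hT (subset_span (by simp))))
  refine h.eq_sec_of_le (h.isBase_span_quadruple H).2.1 ?_
    (TS.span_pair h.symm H.e₁_mem H.e₂_mem H.e₁e₁ H.e₂e₂ H.e₁e₂)
    (TS.span_pair h.symm H.f₁_mem H.f₂_mem H.f₁f₁ H.f₂f₂ H.f₁f₂) hT hT' hZ h1 h2
  rw [← span_union]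
  refine span_mono ?_
  rintro x (rfl | rfl | rfl | rfl) <;> simp

/-- The lines join the vertex to two nonorthogonal points of the conic. -/
theorem exists_lines_subset_cone {Z : Set (ℙ K V)} (hZ : Z ∈ affCones T B q ∪ projCones T B q) :
    ∃ Y ∈ lines T B q, ∃ Y' ∈ lines T B q, Y ⊆ Z ∧ Y' ⊆ Z ∧ Y ≠ Y' := by
  obtain ⟨a, D, H, rfl⟩ := h.mem_cones_iff.1 hZ
  obtain ⟨u, hu, v, hv, huu, hvv, huv⟩ := h.exists_hyperbolic_pair H.base
  have hvu : β v u ≠ 0 := by rwa [h.symm]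
  have hW := H.base.1
  have hau := H.orth u hu
  have hav := H.orth v hv
  refine ⟨_, h.sec_span_pair_mem_lines H.mem (hW hu) H.ne_zero H.singular huu hau hav huv,
    _, h.sec_span_pair_mem_lines H.mem (hW hv) H.ne_zero H.singular hvv hav hau hvu,
    sec_mono ?_, sec_mono ?_, fun heq => ?_⟩
  · rw [span_le]
    rintro x (rfl | rfl)
    exacts [mem_sup_left (mem_span_singleton_self _), mem_sup_right hu]
  · rw [span_le]
    rintro x (rfl | rfl)
    exacts [mem_sup_left (mem_span_singleton_self _), mem_sup_right hv]
  · have h1 := h.sec_subset_iff.1 heq.subset u (hW hu) huu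
      (fun hT => huv (h.vertex_left _ hT _)) (subset_span (by simp))
    obtain ⟨r, s, hrs⟩ := mem_span_pair.1 h1
    exact huv (by simp [← hrs, hav, hvv])

theorem exists_ne_of_subset_cone (hdim : finrank K T + 4 ≤ finrank K (T ⊔ B : Submodule K V))
    {Y Y' Z : Set (ℙ K V)} (hZ : Z ∈ affCones T B q ∪ projCones T B q) (hY : Y ∈ lines T B q)
    (hY' : Y' ∈ lines T B q) (hYZ : Y ⊆ Z) (hYZ' : Y' ⊆ Z) (hne : Y ≠ Y') :
    ∃ Z' ∈ subspaces2 T B q, Y ⊆ Z' ∧ Y' ⊆ Z' ∧ Z' ≠ Z := by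
  obtain ⟨a, D, H, rfl⟩ := h.mem_cones_iff.1 hZ
  obtain ⟨U, hU, hts, hT, rfl⟩ := h.mem_lines_iff.1 hY
  obtain ⟨U', hU', hts', hT', rfl⟩ := h.mem_lines_iff.1 hY'
  exact h.exists_ne_sec_cone hdim H ((h.sec_subset_iff_of_TS hts hT).1 hYZ)
    ((h.sec_subset_iff_of_TS hts' hT').1 hYZ') hts hts' hU hU' (by rintro rfl; exact hne rfl)

/-- A 2-subspace sharing two lines with another one is a cone or a Minkowski plane. -/
theorem cone_or_minkowski {Y Y' Z Z' : Set (ℙ K V)} (hZ : Z ∈ subspaces2 T B q)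
    (hZ' : Z' ∈ subspaces2 T B q) (hY : Y ∈ lines T B q) (hY' : Y' ∈ lines T B q) (hne : Y ≠ Y')
    (hZZ : Z' ≠ Z) (h1 : Y ⊆ Z) (h2 : Y' ⊆ Z) (h3 : Y ⊆ Z') (h4 : Y' ⊆ Z') :
    Z ∈ affCones T B q ∪ projCones T B q ∨ Z ∈ minkowskiPlanes T B q := by
  obtain ⟨U, hU, hts, hT, rfl⟩ := h.mem_lines_iff.1 hY
  obtain ⟨U', hU', hts', hT', rfl⟩ := h.mem_lines_iff.1 hY'
  rcases h.mem_subspaces2_cases hZ with ⟨E, htsE, hf, hTE, rfl⟩ | hZ | hZ | hZ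
  · exact absurd (h.eq_sec_plane htsE hf ((h.sec_subset_iff_of_TS hts hT).1 h1)
      ((h.sec_subset_iff_of_TS hts' hT').1 h2) hU hU' hT hT' (by rintro rfl; exact hne rfl) hZ'
      h3 h4) hZZ
  · exact Or.inl hZ
  · obtain ⟨D, hD, rfl⟩ := h.mem_coneClass_iff_isBase.1 hZ
    have := (h.isBase_iff.1 hD).2.2.2.2 U ((h.sec_subset_iff_of_TS hts hT).1 h1) hts
    omega
  · exact Or.inr hZ

/-- Conversely, one shared pair leaves only cones and Minkowski planes, and a skew pair of lines
excludes the latter. -/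
theorem mem_cones_iff_lines (hdim : finrank K T + 4 ≤ finrank K (T ⊔ B : Submodule K V))
    {Z : Set (ℙ K V)} (hZ : Z ∈ subspaces2 T B q) :
    Z ∈ affCones T B q ∪ projCones T B q ↔
      (∃ Y ∈ lines T B q, ∃ Y' ∈ lines T B q, Y ⊆ Z ∧ Y' ⊆ Z ∧ Y ≠ Y') ∧
      (∀ Y ∈ lines T B q, ∀ Y' ∈ lines T B q, Y ⊆ Z → Y' ⊆ Z → Y ≠ Y' →
        ∃ Z' ∈ subspaces2 T B q, Y ⊆ Z' ∧ Y' ⊆ Z' ∧ Z' ≠ Z) := by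
  constructor
  · exact fun hc => ⟨h.exists_lines_subset_cone hc, fun Y hY Y' hY' h1 h2 hne =>
      h.exists_ne_of_subset_cone hdim hc hY hY' h1 h2 hne⟩
  · rintro ⟨⟨Y, hY, Y', hY', h1, h2, hne⟩, hall⟩
    obtain ⟨Z', hZ', h3, h4, hZZ⟩ := hall Y hY Y' hY' h1 h2 hne
    refine (h.cone_or_minkowski hZ hZ' hY hY' hne hZZ h1 h2 h3 h4).resolve_right fun hm => ?_
    obtain ⟨D, hD, rfl⟩ := h.mem_coneClass_iff_isBase.1 hm
    obtain ⟨e₁, e₂, f₁, f₂, H, rfl⟩ := h.exists_isHyperbolic hD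
    obtain ⟨Z', hZ', h5, h6, h7⟩ := hall _ (h.sec_pair_mem_lines H).1 _
      (h.sec_pair_mem_lines (H.swap h)).1 (sec_mono (span_mono (by
        rintro x (rfl | rfl) <;> simp))) (sec_mono (span_mono (by
        rintro x (rfl | rfl) <;> simp))) (h.sec_pair_ne H).2
    exact h7 (h.eq_sec_hyperbolic H hZ' h5 h6)

theorem notMem_cones_of_minkowski (hdim : finrank K T + 4 ≤ finrank K (T ⊔ B : Submodule K V))
    {Z : Set (ℙ K V)} (hm : Z ∈ minkowskiPlanes T B q) :
    Z ∉ affCones T B q ∪ projCones T B q := by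
  intro hc
  obtain ⟨D, hD, rfl⟩ := h.mem_coneClass_iff_isBase.1 hm
  obtain ⟨e₁, e₂, f₁, f₂, H, rfl⟩ := h.exists_isHyperbolic hD
  obtain ⟨Z', hZ', h5, h6, h7⟩ := h.exists_ne_of_subset_cone hdim hc (h.sec_pair_mem_lines H).1
    (h.sec_pair_mem_lines (H.swap h)).1 (sec_mono (span_mono (by
      rintro x (rfl | rfl) <;> simp))) (sec_mono (span_mono (by
      rintro x (rfl | rfl) <;> simp))) (h.sec_pair_ne H).2
  exact h7 (h.eq_sec_hyperbolic H hZ' h5 h6)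

theorem mem_minkowskiPlanes_iff_lines
    (hdim : finrank K T + 4 ≤ finrank K (T ⊔ B : Submodule K V))
    (hdim' : 5 ≤ finrank K (T ⊔ B : Submodule K V)) {Z : Set (ℙ K V)}
    (hZ : Z ∈ subspaces2 T B q) :
    Z ∈ minkowskiPlanes T B q ↔
      (∃ Z' ∈ subspaces2 T B q, ∃ Y ∈ lines T B q, ∃ Y' ∈ lines T B q,
        Y ≠ Y' ∧ Z ≠ Z' ∧ Y ⊆ Z ∧ Y' ⊆ Z ∧ Y ⊆ Z' ∧ Y' ⊆ Z') ∧
      Z ∉ affCones T B q ∪ projCones T B q := by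
  constructor
  · intro hm
    refine ⟨?_, h.notMem_cones_of_minkowski hdim hm⟩
    obtain ⟨D, hD, rfl⟩ := h.mem_coneClass_iff_isBase.1 hm
    obtain ⟨e₁, e₂, f₁, f₂, H, rfl⟩ := h.exists_isHyperbolic hD
    obtain ⟨Z', hZ', h1, h2, h3⟩ := h.exists_ne_sec_hyperbolic hdim' H
    exact ⟨Z', hZ', _, (h.sec_pair_mem_lines H).1, _, (h.sec_pair_mem_lines H).2,
      (h.sec_pair_ne H).1, h3.symm, sec_mono (span_mono (by rintro x (rfl | rfl) <;> simp)),
      sec_mono (span_mono (by rintro x (rfl | rfl) <;> simp)), h1, h2⟩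
  · rintro ⟨⟨Z', hZ', Y, hY, Y', hY', hne, hZZ, h1, h2, h3, h4⟩, hc⟩
    exact (h.cone_or_minkowski hZ hZ' hY hY' hne hZZ.symm h1 h2 h3 h4).resolve_left hc

omit h [FiniteDimensional K V] in
variable (T B q) in
/-- The 1-subspace `Y` of the 2-subspace `Z` lies, with another one, in another 2-subspace. Such a
1-subspace is a line. -/
def SharedLine (Z Y : Set (ℙ K V)) : Prop :=
  ∃ Y' ∈ subspaces1 T B q, ∃ Z' ∈ subspaces2 T B q, Y' ≠ Y ∧ Z' ≠ Z ∧
    Y ⊆ Z ∧ Y' ⊆ Z ∧ Y ⊆ Z' ∧ Y' ⊆ Z'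

theorem mem_lines_of_sharedLine {Y Z : Set (ℙ K V)} (hZ : Z ∈ subspaces2 T B q)
    (hY : Y ∈ subspaces1 T B q) (hYZ : SharedLine T B q Z Y) : Y ∈ lines T B q := by
  obtain ⟨Y', hY', Z', hZ', hne, hZZ, h1, h2, h3, h4⟩ := hYZ
  exact h.mem_lines_of_subset hY hY' hZ hZ' hne.symm hZZ.symm h1 h2 h3 h4

theorem mem_minkowskiPlanes_iff_sharedLine
    (hdim : finrank K T + 4 ≤ finrank K (T ⊔ B : Submodule K V))
    (hdim' : 5 ≤ finrank K (T ⊔ B : Submodule K V)) {Z : Set (ℙ K V)}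
    (hZ : Z ∈ subspaces2 T B q) :
    Z ∈ minkowskiPlanes T B q ↔ (∃ Y ∈ subspaces1 T B q, SharedLine T B q Z Y) ∧
      Z ∉ affCones T B q ∪ projCones T B q := by
  rw [h.mem_minkowskiPlanes_iff_lines hdim hdim' hZ]
  refine and_congr_left fun _ => ?_
  constructor
  · rintro ⟨Z', hZ', Y, hY, Y', hY', hne, hZZ, h1, h2, h3, h4⟩
    exact ⟨Y, Or.inr hY, Y', Or.inr hY', Z', hZ', hne.symm, hZZ.symm, h1, h2, h3, h4⟩
  · rintro ⟨Y, hY, Y', hY', Z', hZ', hne, hZZ, h1, h2, h3, h4⟩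
    exact ⟨Z', hZ', Y, h.mem_lines_of_subset hY hY' hZ hZ' hne.symm hZZ.symm h1 h2 h3 h4,
      Y', h.mem_lines_of_subset hY' hY hZ hZ' hne hZZ.symm h2 h1 h4 h3, hne.symm, hZZ.symm,
      h1, h2, h3, h4⟩

/-- Line-free form of `mem_cones_iff_lines`. It survives the restriction to shared lines because
both members of a skew pair in a Minkowski plane are shared. -/
theorem mem_cones_iff_sharedLine
    (hdim : finrank K T + 4 ≤ finrank K (T ⊔ B : Submodule K V))
    (hdim' : 5 ≤ finrank K (T ⊔ B : Submodule K V)) {Z : Set (ℙ K V)}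
    (hZ : Z ∈ subspaces2 T B q) :
    Z ∈ affCones T B q ∪ projCones T B q ↔ (∃ Y ∈ subspaces1 T B q, SharedLine T B q Z Y) ∧
      ∀ Y ∈ subspaces1 T B q, ∀ Y' ∈ subspaces1 T B q, SharedLine T B q Z Y →
        SharedLine T B q Z Y' → Y ≠ Y' →
        ∃ Z' ∈ subspaces2 T B q, Y ⊆ Z' ∧ Y' ⊆ Z' ∧ Z' ≠ Z := by
  constructor
  · intro hc
    constructor
    · obtain ⟨Y, hY, Y', hY', h1, h2, hne⟩ := h.exists_lines_subset_cone hc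
      obtain ⟨Z', hZ', h3, h4, hZZ⟩ := h.exists_ne_of_subset_cone hdim hc hY hY' h1 h2 hne
      exact ⟨Y, Or.inr hY, Y', Or.inr hY', Z', hZ', hne.symm, hZZ, h1, h2, h3, h4⟩
    · intro Y hY Y' hY' hs hs' hne
      have hYZ : Y ⊆ Z := by
        obtain ⟨_, _, _, _, _, _, h1, _⟩ := hs
        exact h1
      have hYZ' : Y' ⊆ Z := by
        obtain ⟨_, _, _, _, _, _, h1, _⟩ := hs'
        exact h1
      exact h.exists_ne_of_subset_cone hdim hc (h.mem_lines_of_sharedLine hZ hY hs)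
        (h.mem_lines_of_sharedLine hZ hY' hs') hYZ hYZ' hne
  · rintro ⟨hex, hall⟩
    by_contra hc
    obtain ⟨D, hD, rfl⟩ := h.mem_coneClass_iff_isBase.1
      ((h.mem_minkowskiPlanes_iff_sharedLine hdim hdim' hZ).2 ⟨hex, hc⟩)
    obtain ⟨e₁, e₂, f₁, f₂, H, rfl⟩ := h.exists_isHyperbolic hD
    -- The line through `e₁`, `e₂` is shared thanks to the intersecting line through `e₁`, `f₂`;
    -- this uses dimension at least five.
    have hshared : ∀ {e₁ e₂ f₁ f₂ : V}, IsHyperbolic T B β e₁ e₂ f₁ f₂ →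
        SharedLine T B q (sec T B q (span K {e₁, e₂, f₁, f₂})) (sec T B q (span K {e₁, e₂})) := by
      intro e₁ e₂ f₁ f₂ H
      obtain ⟨Z', hZ', h1, h2, h3⟩ := h.exists_ne_sec_hyperbolic hdim' H
      exact ⟨_, Or.inr (h.sec_pair_mem_lines H).2, Z', hZ', (h.sec_pair_ne H).1.symm, h3,
        sec_mono (span_mono (by rintro x (rfl | rfl) <;> simp)),
        sec_mono (span_mono (by rintro x (rfl | rfl) <;> simp)), h1, h2⟩
    obtain ⟨Z', hZ', h1, h2, h3⟩ := hall _ (Or.inr (h.sec_pair_mem_lines H).1) _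
      (Or.inr (h.sec_pair_mem_lines (H.swap h)).1) (hshared H)
      (span_swap (K := K) e₁ e₂ f₁ f₂ ▸ hshared (H.swap h)) (h.sec_pair_ne H).2
    exact h3 (h.eq_sec_hyperbolic H hZ' h1 h2)

/-- If `T` is zero and `B` has dimension four, then the only 2-subspaces are Minkowski planes. -/
theorem minkowski_of_finrank_eq_four (hruled : Ruled q) (hT : T = ⊥)
    (hf : finrank K (T ⊔ B : Submodule K V) = 4) {Z : Set (ℙ K V)} (hZ : Z ∈ subspaces2 T B q) :
    Z ∈ minkowskiPlanes T B q ∧ Z ∉ affCones T B q ∪ projCones T B q := by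
  -- The radical `T` vanishes, so there are no cone vertices and no totally singular subspaces of
  -- dimension three.
  have hnd : Nondeg β (T ⊔ B) := fun x hx hx0 => by simpa [hT] using h.radical x hx hx0
  have hcone : Z ∉ affCones T B q ∪ projCones T B q := fun hc => by
    obtain ⟨a, D, H, rfl⟩ := h.mem_cones_iff.1 hc
    have hle : K ∙ a ⊔ D ≤ T ⊔ B := sup_le ((span_singleton_le_iff_mem _ _).2 H.mem) H.base.1
    have heq := eq_of_le_of_finrank_eq hle ((h.finrank_cone H).trans hf.symm)
    exact H.ne_zero (hnd a H.mem fun y hy => apply_cone H (heq ▸ hy))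
  refine ⟨?_, hcone⟩
  rcases h.mem_subspaces2_cases hZ with ⟨E, hts, hE, -⟩ | hZ | hZ | hZ
  · have := hnd.two_mul_finrank_le h.two_ne h.symm (fun x hx => (hts x hx).1) hts
    omega
  · exact absurd hZ hcone
  · obtain ⟨D, hD, rfl⟩ := h.mem_coneClass_iff_isBase.1 hZ
    -- A Möbius plane would be the whole quadric, which is ruled.
    obtain ⟨U, hU, hU2⟩ := h.exists_TS_of_ruled hruled
    have heq := eq_of_le_of_finrank_eq hD.1 (hD.2.1.trans hf.symm)
    have := (h.isBase_iff.1 hD).2.2.2.2 U (heq ▸ fun x hx => (hU x hx).1) hU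
    omega
  · exact hZ

end IsPolar

end Laguerre

/-! ### First-order definability -/

namespace Laguerre

section Definability

open FirstOrder FirstOrder.Language

variable {K V : Type*} [Field K] [AddCommGroup V] [Module K V]
variable {T B : Submodule K V} {q : QuadraticForm K B}

theorem grIncl_iff {x y : Gr T B q} :
    grIncl x y ↔ ∃ (Y : subspaces1 T B q) (Z : subspaces2 T B q),
      x = Sum.inl Y ∧ y = Sum.inr Z ∧ Y.1 ⊆ Z.1 := by
  constructor
  · rcases x with Y | Y <;> rcases y with Z | Z
    exacts [False.elim, fun hYZ => ⟨Y, Z, rfl, rfl, hYZ⟩, False.elim, False.elim]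
  · rintro ⟨Y, Z, rfl, rfl, hYZ⟩
    exact hYZ

/-- `SharedLine` for elements of the Grassmann space. -/
def GrShared (z y : Gr T B q) : Prop :=
  ∃ y' z', y' ≠ y ∧ z' ≠ z ∧ grIncl y z ∧ grIncl y' z ∧ grIncl y z' ∧ grIncl y' z'

/-- Inclusion holds only from the first sort to the second, so the sorts need no mention in the
formula. -/
theorem grShared_iff {z y : Gr T B q} :
    GrShared z y ↔ ∃ (Y : subspaces1 T B q) (Z : subspaces2 T B q),
      y = Sum.inl Y ∧ z = Sum.inr Z ∧ IsPolar.SharedLine T B q Z.1 Y.1 := by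
  constructor
  · rintro ⟨y', z', hne, hzz, h1, h2, h3, h4⟩
    obtain ⟨Y, Z, rfl, rfl, h1⟩ := grIncl_iff.1 h1
    obtain ⟨Y', Z', rfl, rfl, h4⟩ := grIncl_iff.1 h4
    exact ⟨Y, Z, rfl, rfl, Y', Y'.2, Z', Z'.2, fun h => hne (congrArg _ (Subtype.ext h)),
      fun h => hzz (congrArg _ (Subtype.ext h)), h1, h2, h3, h4⟩
  · rintro ⟨Y, Z, rfl, rfl, Y', hY', Z', hZ', hne, hzz, h1, h2, h3, h4⟩
    exact ⟨Sum.inl ⟨Y', hY'⟩, Sum.inr ⟨Z', hZ'⟩,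
      fun h => hne (congrArg Subtype.val (Sum.inl.inj h)),
      fun h => hzz (congrArg Subtype.val (Sum.inr.inj h)), h1, h2, h3, h4⟩

/-- The formula `x ⊆ y`. -/
def inclFormula {n : ℕ} (x y : grLanguage.Term (Fin 1 ⊕ Fin n)) :
    grLanguage.BoundedFormula (Fin 1) n :=
  Relations.boundedFormula₂ (L := grLanguage) (n := n) GrRel.incl x y

theorem realize_inclFormula {n : ℕ} {x y : grLanguage.Term (Fin 1 ⊕ Fin n)}
    {v : Fin 1 → Gr T B q} {xs : Fin n → Gr T B q} :
    (inclFormula x y).Realize v xs ↔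
      grIncl (x.realize (Sum.elim v xs)) (y.realize (Sum.elim v xs)) :=
  BoundedFormula.realize_rel₂

/-- The formula saying that `y` is a shared line of the 2-subspace given by the free variable. -/
def sharedFormula {n : ℕ} (y : Fin n) : grLanguage.BoundedFormula (Fin 1) n :=
  let Z : grLanguage.Term (Fin 1 ⊕ Fin (n + 2)) := Term.var (Sum.inl 0)
  -- The two quantifiers add the variables of index `n` for `Y'` and `n + 1` for `Z'`; `y` is lifted
  -- past both.
  let Y : grLanguage.Term (Fin 1 ⊕ Fin (n + 2)) := Term.var (Sum.inr y.castSucc.castSucc)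
  let Y' : grLanguage.Term (Fin 1 ⊕ Fin (n + 2)) := Term.var (Sum.inr (Fin.last n).castSucc)
  let Z' : grLanguage.Term (Fin 1 ⊕ Fin (n + 2)) := Term.var (Sum.inr (Fin.last (n + 1)))
  BoundedFormula.ex (BoundedFormula.ex (∼(Y'.bdEqual Y) ⊓ (∼(Z'.bdEqual Z) ⊓ (inclFormula Y Z ⊓
    (inclFormula Y' Z ⊓ (inclFormula Y Z' ⊓ inclFormula Y' Z'))))))

theorem realize_sharedFormula {n : ℕ} {y : Fin n} {v : Fin 1 → Gr T B q}
    {xs : Fin n → Gr T B q} : (sharedFormula y).Realize v xs ↔ GrShared (v 0) (xs y) := by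
  simp only [sharedFormula, BoundedFormula.realize_ex, BoundedFormula.realize_inf,
    BoundedFormula.realize_not, BoundedFormula.realize_bdEqual, realize_inclFormula,
    Term.realize_var, Sum.elim_inl, Sum.elim_inr, Fin.snoc_castSucc, Fin.snoc_last, GrShared, ne_eq]

/-- The formula saying that the free variable is a 2-subspace with a shared line. -/
def hasSharedFormula : grLanguage.Formula (Fin 1) :=
  BoundedFormula.ex (n := 0) (sharedFormula (Fin.last 0))

theorem realize_hasSharedFormula {v : Fin 1 → Gr T B q} :
    hasSharedFormula.Realize v ↔ ∃ y, GrShared (v 0) y := by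
  simp only [hasSharedFormula, Formula.Realize, BoundedFormula.realize_ex, realize_sharedFormula,
    Fin.snoc_last]

/-- The formula saying that the free variable has shared lines, any two of which lie in another
2-subspace. -/
def coneFormula : grLanguage.Formula (Fin 1) :=
  let Z : grLanguage.Term (Fin 1 ⊕ Fin 3) := Term.var (Sum.inl 0)
  let Y : grLanguage.Term (Fin 1 ⊕ Fin 3) := Term.var (Sum.inr (Fin.last 0).castSucc.castSucc)
  let Y' : grLanguage.Term (Fin 1 ⊕ Fin 3) := Term.var (Sum.inr (Fin.last 1).castSucc)
  let Z' : grLanguage.Term (Fin 1 ⊕ Fin 3) := Term.var (Sum.inr (Fin.last 2))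
  hasSharedFormula ⊓ BoundedFormula.all (n := 0) (BoundedFormula.all
    (sharedFormula (Fin.last 0).castSucc ⟹ sharedFormula (Fin.last 1) ⟹
      ∼(Term.bdEqual (n := 2) (Term.var (Sum.inr (Fin.last 0).castSucc))
        (Term.var (Sum.inr (Fin.last 1)))) ⟹
      BoundedFormula.ex (inclFormula Y Z' ⊓ (inclFormula Y' Z' ⊓ ∼(Z'.bdEqual Z)))))

theorem realize_coneFormula {v : Fin 1 → Gr T B q} :
    coneFormula.Realize v ↔ (∃ y, GrShared (v 0) y) ∧ ∀ y y', GrShared (v 0) y →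
      GrShared (v 0) y' → y ≠ y' → ∃ z', grIncl y z' ∧ grIncl y' z' ∧ z' ≠ v 0 := by
  rw [coneFormula, Formula.realize_inf, realize_hasSharedFormula]
  simp only [Formula.Realize, BoundedFormula.realize_all, BoundedFormula.realize_imp,
    BoundedFormula.realize_ex, BoundedFormula.realize_inf, realize_sharedFormula,
    BoundedFormula.realize_not, BoundedFormula.realize_bdEqual, realize_inclFormula,
    Term.realize_var, Sum.elim_inl, Sum.elim_inr, Fin.snoc_castSucc, Fin.snoc_last, ne_eq]

/-- The formula saying that the free variable is a 2-subspace. -/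
def twoFormula : grLanguage.Formula (Fin 1) :=
  Relations.formula₁ (L := grLanguage) GrRel.isTwo (Term.var 0)

theorem realize_twoFormula {v : Fin 1 → Gr T B q} :
    twoFormula.Realize v ↔ ∃ Z : subspaces2 T B q, v 0 = Sum.inr Z :=
  Formula.realize_rel₁

theorem definableClass_of_formula {𝒳 : Set (Set (ℙ K V))} (φ : grLanguage.Formula (Fin 1))
    (hφ : ∀ v : Fin 1 → Gr T B q,
      φ.Realize v ↔ ∃ Z : subspaces2 T B q, v 0 = Sum.inr Z ∧ Z.1 ∈ 𝒳) :
    DefinableClass T B q 𝒳 :=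
  Set.empty_definable_iff.2 ⟨φ, Set.ext fun v => (hφ v).symm⟩

namespace IsPolar

variable {β : LinearMap.BilinForm K V} (h : IsPolar T B q β) [FiniteDimensional K V]
include h

theorem realize_coneFormula_iff
    (hdim : Module.finrank K T + 4 ≤ Module.finrank K (T ⊔ B : Submodule K V))
    (hdim' : 5 ≤ Module.finrank K (T ⊔ B : Submodule K V)) (v : Fin 1 → Gr T B q) :
    coneFormula.Realize v ↔
      ∃ Z : subspaces2 T B q, v 0 = Sum.inr Z ∧ Z.1 ∈ affCones T B q ∪ projCones T B q := by
  rw [realize_coneFormula]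
  constructor
  · rintro ⟨⟨y, hy⟩, hall⟩
    obtain ⟨Y, Z, rfl, hz, hs⟩ := grShared_iff.1 hy
    refine ⟨Z, hz, (h.mem_cones_iff_sharedLine hdim hdim' Z.2).2 ⟨⟨Y, Y.2, hs⟩, ?_⟩⟩
    intro Y₁ hY₁ Y₂ hY₂ hs₁ hs₂ hne
    obtain ⟨z', h1, h2, h3⟩ := hall (Sum.inl ⟨Y₁, hY₁⟩) (Sum.inl ⟨Y₂, hY₂⟩)
      (grShared_iff.2 ⟨⟨Y₁, hY₁⟩, Z, rfl, hz, hs₁⟩) (grShared_iff.2 ⟨⟨Y₂, hY₂⟩, Z, rfl, hz, hs₂⟩)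
      fun heq => hne (congrArg Subtype.val (Sum.inl.inj heq))
    obtain ⟨_, Z', -, rfl, -⟩ := grIncl_iff.1 h1
    exact ⟨Z', Z'.2, h1, h2, fun heq => h3 (by rw [hz]; exact congrArg _ (Subtype.ext heq))⟩
  · rintro ⟨Z, hz, hZ⟩
    obtain ⟨⟨Y, hY, hs⟩, hall⟩ := (h.mem_cones_iff_sharedLine hdim hdim' Z.2).1 hZ
    refine ⟨⟨Sum.inl ⟨Y, hY⟩, grShared_iff.2 ⟨⟨Y, hY⟩, Z, rfl, hz, hs⟩⟩, ?_⟩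
    intro y y' hy hy' hne
    obtain ⟨Y₁, Z₁, rfl, hz₁, hs₁⟩ := grShared_iff.1 hy
    obtain ⟨Y₂, Z₂, rfl, hz₂, hs₂⟩ := grShared_iff.1 hy'
    obtain rfl : Z₁ = Z := Sum.inr.inj (hz₁.symm.trans hz)
    obtain rfl : Z₂ = Z₁ := Sum.inr.inj (hz₂.symm.trans hz)
    obtain ⟨Z', hZ', h1, h2, h3⟩ := hall Y₁ Y₁.2 Y₂ Y₂.2 hs₁ hs₂
      fun heq => hne (congrArg _ (Subtype.ext heq))
    refine ⟨Sum.inr ⟨Z', hZ'⟩, h1, h2, fun heq => h3 ?_⟩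
    exact congrArg Subtype.val (Sum.inr.inj (heq.trans hz))

theorem realize_minkowskiFormula_iff
    (hdim : Module.finrank K T + 4 ≤ Module.finrank K (T ⊔ B : Submodule K V))
    (hdim' : 5 ≤ Module.finrank K (T ⊔ B : Submodule K V)) (v : Fin 1 → Gr T B q) :
    (hasSharedFormula ⊓ ∼coneFormula).Realize v ↔
      ∃ Z : subspaces2 T B q, v 0 = Sum.inr Z ∧ Z.1 ∈ minkowskiPlanes T B q := by
  rw [Formula.realize_inf, Formula.realize_not, realize_hasSharedFormula,
    h.realize_coneFormula_iff hdim hdim']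
  constructor
  · rintro ⟨⟨y, hy⟩, hc⟩
    obtain ⟨Y, Z, rfl, hz, hs⟩ := grShared_iff.1 hy
    exact ⟨Z, hz, (h.mem_minkowskiPlanes_iff_sharedLine hdim hdim' Z.2).2
      ⟨⟨Y, Y.2, hs⟩, fun hZ => hc ⟨Z, hz, hZ⟩⟩⟩
  · rintro ⟨Z, hz, hZ⟩
    obtain ⟨⟨Y, hY, hs⟩, hc⟩ := (h.mem_minkowskiPlanes_iff_sharedLine hdim hdim' Z.2).1 hZ
    refine ⟨⟨Sum.inl ⟨Y, hY⟩, grShared_iff.2 ⟨⟨Y, hY⟩, Z, rfl, hz, hs⟩⟩, ?_⟩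
    rintro ⟨Z', hz', hZ'⟩
    obtain rfl : Z' = Z := Sum.inr.inj (hz'.symm.trans hz)
    exact hc hZ'

end IsPolar

end Definability

end Laguerre

theorem mainTheorem9 {K V : Type*} [Field K] [AddCommGroup V] [Module K V]
    [FiniteDimensional K V] (hK : (2 : K) ≠ 0)
    (T B : Submodule K V) (hTB : Disjoint T B)
    (q : QuadraticForm K B) (hq : (QuadraticMap.polarBilin q).Nondegenerate)
    (hruled : Laguerre.Ruled q) :
    (∀ Z ∈ Laguerre.subspaces2 T B q,
      (Z ∈ Laguerre.affCones T B q ∪ Laguerre.projCones T B q ↔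
        (∃ Y ∈ Laguerre.lines T B q, ∃ Y' ∈ Laguerre.lines T B q, Y ⊆ Z ∧ Y' ⊆ Z ∧ Y ≠ Y') ∧
        (∀ Y ∈ Laguerre.lines T B q, ∀ Y' ∈ Laguerre.lines T B q, Y ⊆ Z → Y' ⊆ Z → Y ≠ Y' →
          ∃ Z' ∈ Laguerre.subspaces2 T B q, Y ⊆ Z' ∧ Y' ⊆ Z' ∧ Z' ≠ Z))) ∧
    (5 ≤ Module.finrank K (T ⊔ B : Submodule K V) →
      ∀ Z ∈ Laguerre.subspaces2 T B q,
      (Z ∈ Laguerre.minkowskiPlanes T B q ↔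
        (∃ Z' ∈ Laguerre.subspaces2 T B q,
          ∃ Y ∈ Laguerre.lines T B q, ∃ Y' ∈ Laguerre.lines T B q,
          Y ≠ Y' ∧ Z ≠ Z' ∧ Y ⊆ Z ∧ Y' ⊆ Z ∧ Y ⊆ Z' ∧ Y' ⊆ Z') ∧
        Z ∉ Laguerre.affCones T B q ∪ Laguerre.projCones T B q)) ∧
    Laguerre.DefinableClass T B q (Laguerre.affCones T B q ∪ Laguerre.projCones T B q) ∧
    Laguerre.DefinableClass T B q (Laguerre.minkowskiPlanes T B q) := by
  open Laguerre in
  obtain ⟨β, h⟩ := exists_isPolar hK T B hTB q hq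
  obtain ⟨hB, hsum⟩ := four_le_finrank hK hTB hq hruled
  have hdim : Module.finrank K T + 4 ≤ Module.finrank K (T ⊔ B : Submodule K V) := by omega
  refine ⟨fun Z hZ => h.mem_cones_iff_lines hdim hZ,
    fun hdim' Z hZ => h.mem_minkowskiPlanes_iff_lines hdim hdim' hZ, ?_⟩
  by_cases hdim' : 5 ≤ Module.finrank K (T ⊔ B : Submodule K V)
  · exact ⟨definableClass_of_formula _ (h.realize_coneFormula_iff hdim hdim'),
      definableClass_of_formula _ (h.realize_minkowskiFormula_iff hdim hdim')⟩
  · have hT : T = ⊥ := Submodule.finrank_eq_zero.1 (by omega)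
    have key := fun Z (hZ : Z ∈ subspaces2 T B q) =>
      h.minkowski_of_finrank_eq_four hruled hT (by omega) hZ
    -- There are no cones, and every 2-subspace is a Minkowski plane.
    refine ⟨definableClass_of_formula ⊥ fun v => ?_, definableClass_of_formula twoFormula fun v => ?_⟩
    · rw [FirstOrder.Language.Formula.realize_bot, false_iff]
      rintro ⟨Z, -, hZ⟩
      exact (key Z Z.2).2 hZ
    · rw [realize_twoFormula]
      exact ⟨fun ⟨Z, hZ⟩ => ⟨Z, hZ, (key Z Z.2).1⟩, fun ⟨Z, hZ, _⟩ => ⟨Z, hZ⟩⟩
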